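/- Let $q:[0,\infty)\to\mathbb R$ be locally integrable with $\|q\|:=\sup_{x\ge 0}\int_x^{x+1}|q(s)|\,ds<\infty$. Definitions. A Weyl solution at $z\in\mathbb C$ is a nontrivial solution $u$ of $-u''+qu=zu$ on $[0,\infty)$ ($u,u'$ locally absolutely continuous, equation a.e.) with $\int_0^\infty|u|^2<\infty$; if it is unique up to a factor and $u(0)\ne 0$, the Dirichlet Titchmarsh–Weyl function is $m(z)=u'(0)/u(0)$. The response function is $r(s)=w_x(0,s)$ (one-sided derivative, for a.e. $s>0$), where $w$ is the continuous weak solution on $0\le x\le s$ of the Goursat problem $$w_{ss}-w_{xx}+q(x)w=0\ \ (0<x<s),\qquad w(0,s)=0,\qquad w(x,x)=-\tfrac12\int_0^x q(t)\,dt .$$ The $A$-amplitude is $A(\alpha)=-2r(2\alpha)$. Statement. The response function $r$ exists and is determined by $q$ up to a set of measure zero. For a.e. $\alpha>0$ one has $A(\alpha)=A(\alpha,\alpha)$, where $A(x,y)$, $0\le y\le x$, is any solution of $$A(x,y)=q(x)-\int_0^y\Big(\int_v^x A(u,v)\,du\Big)q(x-v)\,dv$$ for which $A(x,y)-q(x)$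 is continuous, and such a solution exists. For every $k\in\mathbb C$ with $$\operatorname{Re}k>2\max\{\sqrt{2\|q\|},\,e\|q\|\}$$ there is a Weyl solution at $z=-k^2$, it is unique up to a constant factor and does not vanish at $0$, and $$m(-k^2)=-k-\int_0^\infty A(\alpha)e^{-2\alpha k}\,d\alpha=-k+\int_0^\infty e^{-ks}r(s)\,ds ,$$ where both integrals converge absolutely. -/

import Mathlib

open Set MeasureTheory

open scoped ContDiff NNReal

noncomputable section

/-- The windowed norm `sup_{x ≥ 0} ∫_x^{x+1} |q|` (meaningful when the supremum is finite). -/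
def windowNorm (q : ℝ → ℝ) : ℝ :=
  ⨆ x : ℝ≥0, ∫ t in (x : ℝ)..((x : ℝ) + 1), |q t|

/-- `q` is a locally integrable potential on `[0, ∞)` with `sup_{x ≥ 0} ∫_x^{x+1} |q| < ∞`. Values
of `q` on the negative half-line play no role. -/
structure IsUniformlyLocallyIntegrable (q : ℝ → ℝ) : Prop where
  locallyIntegrable : LocallyIntegrableOn q (Ici 0)
  bddAbove : BddAbove (range fun x : ℝ≥0 => ∫ t in (x : ℝ)..((x : ℝ) + 1), |q t|)

/-- `u` solves `-u'' + q u = z u` on `[0, ∞)` in the usual sense for a locally integrable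
potential: `u` is differentiable, and `u'` is an antiderivative of `(q - z) u`, so that `u'` is
locally absolutely continuous and the equation holds almost everywhere. -/
def IsSchrodingerSolution (q : ℝ → ℝ) (z : ℂ) (u : ℝ → ℂ) : Prop :=
  DifferentiableOn ℝ u (Ici 0) ∧
    ∀ x : ℝ, 0 ≤ x →
      derivWithin u (Ici 0) x
        = derivWithin u (Ici 0) 0 + ∫ t in (0 : ℝ)..x, ((q t : ℂ) - z) * u t

/-- A Weyl solution: a nontrivial solution of `-u'' + q u = z u` which is square integrable on
the half-line. -/
structure IsWeylSolution (q : ℝ → ℝ) (z : ℂ) (u : ℝ → ℂ) : Prop where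
  solution : IsSchrodingerSolution q z u
  nontrivial : ∃ x : ℝ, 0 ≤ x ∧ u x ≠ 0
  squareIntegrable : IntegrableOn (fun x => ‖u x‖ ^ 2) (Ioi 0)

open Classical in
/-- The Dirichlet Titchmarsh-Weyl function `m(z) = u₊'(0, z) / u₊(0, z)`, where `u₊(·, z)` is a
Weyl solution. The quotient does not depend on the choice when the Weyl solution is unique up to
a factor (and it is a finite number when `u₊(0, z) ≠ 0`). -/
def titchmarshWeylM (q : ℝ → ℝ) (z : ℂ) : ℂ :=
  if h : ∃ u : ℝ → ℂ, IsWeylSolution q z u then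
    derivWithin h.choose (Ici 0) 0 / h.choose 0
  else 0

/-- `w` is a (continuous, weak) solution of the Goursat problem
`w_ss - w_xx + q(x) w = 0` in `0 < x < s`, `w(0, s) = 0`, `w(x, x) = -½ ∫_0^x q`.
The arguments of `w` are in the order `(x, s)`. -/
structure IsGoursatSolution (q : ℝ → ℝ) (w : ℝ × ℝ → ℝ) : Prop where
  continuousOn : ContinuousOn w {p : ℝ × ℝ | 0 ≤ p.1 ∧ p.1 ≤ p.2}
  boundary : ∀ s : ℝ, 0 ≤ s → w (0, s) = 0
  characteristic : ∀ x : ℝ, 0 ≤ x → w (x, x) = -(1 / 2) * ∫ t in (0 : ℝ)..x, q t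
  weak : ∀ φ : ℝ × ℝ → ℝ, ContDiff ℝ ∞ φ → HasCompactSupport φ →
    tsupport φ ⊆ {p : ℝ × ℝ | 0 < p.1 ∧ p.1 < p.2} →
    ∫ p : ℝ × ℝ,
      (w p * (iteratedDeriv 2 (fun s => φ (p.1, s)) p.2
          - iteratedDeriv 2 (fun x => φ (x, p.2)) p.1)
        + q p.1 * w p * φ p) = 0

/-- `r` is (a version of) the response function: `r(s) = w_x(0, s)` for almost every `s > 0`,
where `w` solves the Goursat problem. -/
def IsResponseFunction (q r : ℝ → ℝ) : Prop :=
  ∃ w : ℝ × ℝ → ℝ, IsGoursatSolution q w ∧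
    ∀ᵐ s ∂(volume.restrict (Ioi (0 : ℝ))),
      HasDerivWithinAt (fun x => w (x, s)) (r s) (Ici 0) 0

/-- The `A`-amplitude `A(α) = -2 r(2α)` belonging to a response function `r`. -/
def aAmplitude (r : ℝ → ℝ) (α : ℝ) : ℝ := -2 * r (2 * α)

/-- `K` solves the Volterra equation
`K(x, y) = q(x) - ∫_0^y (∫_v^x K(u, v) du) q(x - v) dv` for `0 ≤ y ≤ x`,
in the class of kernels for which `K(x, y) - q(x)` is continuous. -/
structure IsVolterraKernel (q : ℝ → ℝ) (K : ℝ → ℝ → ℝ) : Prop where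
  continuousOn :
    ContinuousOn (fun p : ℝ × ℝ => K p.1 p.2 - q p.1) {p : ℝ × ℝ | 0 ≤ p.2 ∧ p.2 ≤ p.1}
  equation : ∀ x y : ℝ, 0 ≤ y → y ≤ x →
    K x y = q x - ∫ v in (0 : ℝ)..y, (∫ u in v..x, K u v) * q (x - v)

end

/-!
In the characteristic coordinates `v = (s - x) / 2`, `X = (s + x) / 2` the Goursat problem for
`w(x, s) = -B(v, X) / 2` becomes the integral equation
`B(v, X) = ∫_v^X (q(u) - ∫_0^v B(v', u) q(u - v') dv') du` on `0 ≤ v ≤ X`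
(`IsCharacteristicKernel`), and every object of the theorem is read off from its solution.

*Existence, uniqueness and growth.* If `N` bounds the integrals of `|q|` over unit windows, then
`∫_p^y e^{-κ(t - p)} |q(t)| dt ≤ N (1 + 1/κ)`. Hence in the norm with weight `e^{κ(v + X)}` the
integral operator has norm at most `N (1 + 1/κ) / κ`, which is less than `1` for every `κ` beyond
the threshold `2 max (√(2N), e N)`. Banach's fixed point theorem gives a solution with
`|B(v, X)| ≤ M e^{κ(v + X)}` (`exists_isCharacteristicKernel`), and the same estimate on triangles
gives uniqueness among all continuous solutions (`IsCharacteristicKernel.eq`).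

*The kernel `A(x, y)` and the response function.* Differentiating in `X`, the function
`A(x, y) = q(x) - ∫_0^y B(v, x) q(x - v) dv` solves the Volterra equation, and every solution of
that equation arises in this way. Testing the weak wave equation with products `b(v) a(X)` and
integrating once in each characteristic direction leads from a weak solution of the Goursat
problem to the kernel equation; two integrations by parts lead back. So the Goursat solution is
unique, and Lebesgue's differentiation theorem gives `w_x(0, s) = -A(s/2, s/2) / 2` for almost
every `s`.

*The Weyl solution.* Put `F(x) = ∫_0^∞ e^{-2kv} B(v, v + x) dv`, which converges if `κ < Re k`. By
Fubini's theorem and the kernel equation `F` is a primitive of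
`G(x) = ∫_x^∞ e^{-2k(t - x)} q(t) (1 - F(t)) dt`, with `F(0) = 0`, and `G(0)` is the Laplace
transform `∫_0^∞ e^{-2kα} A(α, α) dα`. Therefore `u(x) = e^{-kx} (1 - F(x))` solves
`-u'' + q u = -k² u`, decays exponentially together with `u'`, and satisfies `u(0) = 1`,
`u'(0) = -k - G(0)`. For another square integrable solution `v` with Wronskian `W = u v' - u' v`
the identity `(u v)' = W + 2 u' v`, in which `u v` and `u' v` are integrable, forces `W = 0`, and
`v` is a multiple of `u` by uniqueness for the initial value problem.
-/

open Filter Topology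

/-! ### Locally integrable weights -/

theorem MeasureTheory.LocallyIntegrable.intervalIntegrable_real {E : Type*}
    [NormedAddCommGroup E] {f : ℝ → E} (hf : LocallyIntegrable f) (a b : ℝ) :
    IntervalIntegrable f volume a b :=
  (hf.integrableOn_isCompact isCompact_uIcc).intervalIntegrable

theorem MeasureTheory.LocallyIntegrable.abs_real {f : ℝ → ℝ} (hf : LocallyIntegrable f) :
    LocallyIntegrable fun t => |f t| := fun x =>
  let ⟨s, hs, h⟩ := hf x
  ⟨s, hs, h.norm⟩

/-- Continuity of a primitive depending on a parameter, with a locally integrable weight. -/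
theorem continuous_parametric_primitive_mul {X : Type*} [TopologicalSpace X]
    [FirstCountableTopology X] [LocallyCompactSpace X] {g : X → ℝ → ℝ} {q : ℝ → ℝ}
    (hg : Continuous (Function.uncurry g)) (hq : LocallyIntegrable q) (a₀ : ℝ) :
    Continuous fun p : X × ℝ => ∫ t in a₀..p.2, g p.1 t * q t := by
  rw [continuous_iff_continuousAt]
  rintro ⟨x₀, b₀⟩
  obtain ⟨K, hK, hKx⟩ := exists_compact_mem_nhds x₀
  set a := min a₀ b₀ - 1
  set b := max a₀ b₀ + 1
  have ha₀ : a₀ ∈ Ioo a b := ⟨by have := min_le_left a₀ b₀; grind, by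
    have := le_max_left a₀ b₀; grind⟩
  have hb₀ : b₀ ∈ Ioo a b := ⟨by have := min_le_right a₀ b₀; grind, by
    have := le_max_right a₀ b₀; grind⟩
  have hab : a ≤ b := (ha₀.1.trans ha₀.2).le
  obtain ⟨C, hC⟩ := (hK.prod (isCompact_Icc (a := a) (b := b))).exists_bound_of_continuousOn
    hg.continuousOn
  refine intervalIntegral.continuousAt_parametric_primitive_of_dominated
    (F := fun x t => g x t * q t) (fun t => C * |q t|) a b ?_ ?_ ?_ ?_ ha₀ hb₀ (by simp)
  · intro x
    exact ((hg.comp (by fun_prop : Continuous fun t : ℝ => (x, t))).aestronglyMeasurable).mul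
      hq.aestronglyMeasurable.restrict
  · filter_upwards [hKx] with x hx
    refine (ae_restrict_iff' measurableSet_uIoc).2 (Eventually.of_forall fun t ht => ?_)
    rw [uIoc_of_le hab] at ht
    rw [norm_mul]
    exact mul_le_mul_of_nonneg_right (hC (x, t) ⟨hx, Ioc_subset_Icc_self ht⟩) (norm_nonneg _)
  · exact ((LocallyIntegrable.intervalIntegrable_real hq a b).abs).const_mul C
  · refine Eventually.of_forall fun t => ?_
    exact ((hg.comp (by fun_prop : Continuous fun x : X => (x, t))).mul
      continuous_const).continuousAt

/-! ### The kernel equation -/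

/-- The term `∫_0^v B(v', u) q(u - v') dv'` of the kernel equation, written in the variable
`t = u - v'`. -/
noncomputable def innerTerm (q : ℝ → ℝ) (B : ℝ × ℝ → ℝ) (v u : ℝ) : ℝ :=
  ∫ t in (u - v)..u, B (u - t, u) * q t

theorem innerTerm_eq (q : ℝ → ℝ) (B : ℝ × ℝ → ℝ) (v u : ℝ) :
    innerTerm q B v u = ∫ s in (0 : ℝ)..v, B (s, u) * q (u - s) := by
  have := intervalIntegral.integral_comp_sub_left (a := 0) (b := v)
    (fun t => B (u - t, u) * q t) u
  simp only [sub_sub_cancel, sub_zero] at this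
  rw [innerTerm, ← this]

/-- `B` solves the Goursat problem in the characteristic coordinates `v = (s - x) / 2`,
`X = (s + x) / 2`, in which `B(v, X) = -2 w(X - v, X + v)`. Only the values on `0 ≤ v ≤ X` matter;
the continuity on the whole plane is a convenient normalization. -/
structure IsCharacteristicKernel (q : ℝ → ℝ) (B : ℝ × ℝ → ℝ) : Prop where
  continuous : Continuous B
  equation : ∀ v X : ℝ, 0 ≤ v → v ≤ X → B (v, X) = ∫ u in v..X, (q u - innerTerm q B v u)

theorem intervalIntegrable_mul_continuous {q : ℝ → ℝ} (hq : LocallyIntegrable q) {g : ℝ → ℝ}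
    (hg : Continuous g) (a b : ℝ) : IntervalIntegrable (fun t => g t * q t) volume a b :=
  (LocallyIntegrable.intervalIntegrable_real hq a b).continuousOn_mul hg.continuousOn

theorem continuous_innerTerm {q : ℝ → ℝ} (hq : LocallyIntegrable q) {B : ℝ × ℝ → ℝ}
    (hB : Continuous B) : Continuous fun p : ℝ × ℝ => innerTerm q B p.1 p.2 := by
  have h := continuous_parametric_primitive_mul (X := ℝ) (g := fun u t => B (u - t, u))
    (by fun_prop) hq 0
  have h1 : Continuous fun p : ℝ × ℝ => ∫ t in (0 : ℝ)..p.2, B (p.2 - t, p.2) * q t :=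
    h.comp (by fun_prop : Continuous fun p : ℝ × ℝ => (p.2, p.2))
  have h2 : Continuous fun p : ℝ × ℝ => ∫ t in (0 : ℝ)..(p.2 - p.1), B (p.2 - t, p.2) * q t :=
    h.comp (by fun_prop : Continuous fun p : ℝ × ℝ => (p.2, p.2 - p.1))
  refine (h1.sub h2).congr fun p => ?_
  exact intervalIntegral.integral_interval_sub_left
    (intervalIntegrable_mul_continuous hq (by fun_prop) _ _)
    (intervalIntegrable_mul_continuous hq (by fun_prop) _ _)

theorem continuous_integral_innerTerm {q : ℝ → ℝ} (hq : LocallyIntegrable q) {B : ℝ × ℝ → ℝ}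
    (hB : Continuous B) :
    Continuous fun p : ℝ × ℝ => ∫ u in p.1..p.2, innerTerm q B p.1 u := by
  have hc := continuous_innerTerm hq hB
  have h := intervalIntegral.continuous_parametric_primitive_of_continuous (μ := volume) (a₀ := 0)
    (f := fun v u => innerTerm q B v u) hc
  have h2 : Continuous fun p : ℝ × ℝ => ∫ u in (0 : ℝ)..p.1, innerTerm q B p.1 u :=
    h.comp (by fun_prop : Continuous fun p : ℝ × ℝ => (p.1, p.1))
  refine (h.sub h2).congr fun p => ?_
  have hi (a b : ℝ) : IntervalIntegrable (fun u => innerTerm q B p.1 u) volume a b :=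
    (hc.comp (by fun_prop : Continuous fun u : ℝ => (p.1, u))).intervalIntegrable _ _
  exact intervalIntegral.integral_interval_sub_left (hi _ _) (hi _ _)

theorem integral_kernel_eq {q : ℝ → ℝ} (hq : LocallyIntegrable q) {B : ℝ × ℝ → ℝ}
    (hB : Continuous B) (v a b : ℝ) :
    ∫ u in a..b, (q u - innerTerm q B v u) = (∫ u in a..b, q u) - ∫ u in a..b, innerTerm q B v u :=
  intervalIntegral.integral_sub (LocallyIntegrable.intervalIntegrable_real hq _ _)
    (((continuous_innerTerm hq hB).comp
      (by fun_prop : Continuous fun u : ℝ => (v, u))).intervalIntegrable _ _)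

theorem innerTerm_sub {q : ℝ → ℝ} (hq : LocallyIntegrable q) {B₁ B₂ : ℝ × ℝ → ℝ}
    (h₁ : Continuous B₁) (h₂ : Continuous B₂) (v u : ℝ) :
    innerTerm q (B₁ - B₂) v u = innerTerm q B₁ v u - innerTerm q B₂ v u := by
  simp only [innerTerm]
  rw [← intervalIntegral.integral_sub (intervalIntegrable_mul_continuous hq (by fun_prop) _ _)
    (intervalIntegrable_mul_continuous hq (by fun_prop) _ _)]
  simp [sub_mul]

theorem integral_kernel_sub {q : ℝ → ℝ} (hq : LocallyIntegrable q) {B₁ B₂ : ℝ × ℝ → ℝ}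
    (h₁ : Continuous B₁) (h₂ : Continuous B₂) (v a b : ℝ) :
    (∫ u in a..b, (q u - innerTerm q B₁ v u)) - ∫ u in a..b, (q u - innerTerm q B₂ v u)
      = - ∫ u in a..b, innerTerm q (B₁ - B₂) v u := by
  have hi {B : ℝ × ℝ → ℝ} (hB : Continuous B) :
      IntervalIntegrable (fun u => innerTerm q B v u) volume a b :=
    ((continuous_innerTerm hq hB).comp
      (by fun_prop : Continuous fun u : ℝ => (v, u))).intervalIntegrable _ _
  rw [integral_kernel_eq hq h₁, integral_kernel_eq hq h₂]
  simp only [innerTerm_sub hq h₁ h₂]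
  rw [intervalIntegral.integral_sub (hi h₁) (hi h₂)]
  ring

/-! ### Exponential estimates from the windowed bound -/

/-- The windowed bound `∫_p^{p+1} |q| ≤ N` for all `p ≥ 0`; for a uniformly locally integrable
potential `N = windowNorm q` is admissible. -/
def HasWindowBound (q : ℝ → ℝ) (N : ℝ) : Prop :=
  ∀ p : ℝ, 0 ≤ p → ∫ t in p..(p + 1), |q t| ≤ N

theorem HasWindowBound.nonneg {q : ℝ → ℝ} {N : ℝ} (hN : HasWindowBound q N) : 0 ≤ N :=
  (intervalIntegral.integral_nonneg (by norm_num) fun _ _ => abs_nonneg _).trans (hN 0 le_rfl)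

/-- Exponentially weighted integrals of `q` are bounded uniformly in the base point, by induction
on the number of unit windows. -/
theorem HasWindowBound.integral_exp_le {q : ℝ → ℝ} {N : ℝ} (hq : LocallyIntegrable q)
    (hN : HasWindowBound q N) {κ : ℝ} (hκ : 0 < κ) {p y : ℝ} (hp : 0 ≤ p) (hpy : p ≤ y) :
    ∫ t in p..y, Real.exp (-κ * (t - p)) * |q t| ≤ N * (1 + 1 / κ) := by
  have hN0 := hN.nonneg
  have hqa : LocallyIntegrable fun t => |q t| := hq.abs_real
  have hi (p a b : ℝ) : IntervalIntegrable (fun t => Real.exp (-κ * (t - p)) * |q t|) volume a b :=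
    intervalIntegrable_mul_continuous hqa (by fun_prop) _ _
  -- `L = N (1 + 1 / κ)` satisfies `N + exp (-κ) L ≤ L`
  have hL : N + Real.exp (-κ) * (N * (1 + 1 / κ)) ≤ N * (1 + 1 / κ) := by
    have h1 : Real.exp (-κ) * (1 + κ) ≤ 1 := by
      calc Real.exp (-κ) * (1 + κ) ≤ Real.exp (-κ) * Real.exp κ := by
            gcongr; linarith [Real.add_one_le_exp κ]
        _ = 1 := by rw [← Real.exp_add]; simp
    have h2 : Real.exp (-κ) * (1 + 1 / κ) ≤ 1 / κ := by
      rw [le_div_iff₀ hκ]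
      calc Real.exp (-κ) * (1 + 1 / κ) * κ = Real.exp (-κ) * (1 + κ) := by field_simp; ring
        _ ≤ 1 := h1
    nlinarith
  have key : ∀ n : ℕ, ∀ p : ℝ, 0 ≤ p →
      ∫ t in p..(p + n), Real.exp (-κ * (t - p)) * |q t| ≤ N * (1 + 1 / κ) := by
    intro n
    induction n with
    | zero => intro p hp; simp; positivity
    | succ n ih =>
      intro p hp
      rw [← intervalIntegral.integral_add_adjacent_intervals (hi p p (p + 1)) (hi p (p + 1) _)]
      have e : p + ((n + 1 : ℕ) : ℝ) = (p + 1) + n := by push_cast; ring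
      rw [e]
      have h1 : ∫ t in p..(p + 1), Real.exp (-κ * (t - p)) * |q t| ≤ N := by
        refine le_trans ?_ (hN p hp)
        refine intervalIntegral.integral_mono_on (by linarith) (hi _ _ _)
          (LocallyIntegrable.intervalIntegrable_real hqa _ _) fun t ht => ?_
        have : Real.exp (-κ * (t - p)) ≤ 1 := Real.exp_le_one_iff.2 (by nlinarith [ht.1])
        exact mul_le_of_le_one_left (abs_nonneg _) this
      have h2 : ∫ t in (p + 1)..(p + 1 + n), Real.exp (-κ * (t - p)) * |q t|
          = Real.exp (-κ) * ∫ t in (p + 1)..(p + 1 + n), Real.exp (-κ * (t - (p + 1))) * |q t| := by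
        rw [← intervalIntegral.integral_const_mul]
        refine intervalIntegral.integral_congr fun t _ => ?_
        rw [← mul_assoc, ← Real.exp_add]
        ring_nf
      rw [h2]
      have := ih (p + 1) (by linarith)
      have := mul_le_mul_of_nonneg_left this (Real.exp_pos (-κ)).le
      linarith
  obtain ⟨n, hn⟩ := exists_nat_ge (y - p)
  refine le_trans ?_ (key n p hp)
  refine intervalIntegral.integral_mono_interval le_rfl hpy (by linarith) ?_ (hi _ _ _)
  exact Eventually.of_forall fun t => by positivity

theorem HasWindowBound.abs_innerTerm_le {q : ℝ → ℝ} {N : ℝ} (hq : LocallyIntegrable q)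
    (hN : HasWindowBound q N) {κ : ℝ} (hκ : 0 < κ) {D : ℝ × ℝ → ℝ} (hD : Continuous D)
    {M u v : ℝ} (hM : 0 ≤ M) (hv : 0 ≤ v) (hu : v ≤ u)
    (hDM : ∀ v' : ℝ, 0 ≤ v' → v' ≤ u → |D (v', u)| ≤ M * Real.exp (κ * (v' + u))) :
    |innerTerm q D v u| ≤ M * (N * (1 + 1 / κ)) * Real.exp (κ * (v + u)) := by
  have hqa : LocallyIntegrable fun t => |q t| := hq.abs_real
  calc |innerTerm q D v u| ≤ ∫ t in (u - v)..u, |D (u - t, u) * q t| :=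
        intervalIntegral.abs_integral_le_integral_abs (by linarith)
    _ ≤ ∫ t in (u - v)..u,
          M * Real.exp (κ * (v + u)) * (Real.exp (-κ * (t - (u - v))) * |q t|) := by
        refine intervalIntegral.integral_mono_on (by linarith)
          (intervalIntegrable_mul_continuous hq (by fun_prop) _ _).abs
          ((intervalIntegrable_mul_continuous hqa (by fun_prop) _ _).const_mul _) fun t ht => ?_
        rw [abs_mul, ← mul_assoc, mul_assoc M, ← Real.exp_add]
        refine mul_le_mul_of_nonneg_right ?_ (abs_nonneg _)
        refine (hDM (u - t) (by linarith [ht.2]) (by linarith [ht.1])).trans_eq ?_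
        ring_nf
    _ = M * Real.exp (κ * (v + u)) * ∫ t in (u - v)..u, (Real.exp (-κ * (t - (u - v))) * |q t|) :=
        intervalIntegral.integral_const_mul _ _
    _ ≤ M * Real.exp (κ * (v + u)) * (N * (1 + 1 / κ)) := by
        gcongr
        exact hN.integral_exp_le hq hκ (by linarith) (by linarith)
    _ = _ := by ring

theorem integral_exp_mul_le {κ : ℝ} (hκ : 0 < κ) (v X : ℝ) :
    ∫ u in v..X, Real.exp (κ * (v + u)) ≤ Real.exp (κ * (v + X)) / κ := by
  have : ∫ u in v..X, Real.exp (κ * (v + u))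
      = Real.exp (κ * (v + X)) / κ - Real.exp (κ * (v + v)) / κ := by
    refine intervalIntegral.integral_eq_sub_of_hasDerivAt
      (f := fun u => Real.exp (κ * (v + u)) / κ) (fun u _ => ?_)
      (Continuous.intervalIntegrable (by fun_prop) _ _)
    have := (((hasDerivAt_id u).const_add v).const_mul κ).exp.div_const κ
    simpa [hκ.ne'] using this
  rw [this]
  have := Real.exp_pos (κ * (v + v))
  have : 0 ≤ Real.exp (κ * (v + v)) / κ := by positivity
  linarith

/-- The a priori estimate behind existence and uniqueness: in the norm with the weight
`exp (κ (v + X))` the integral operator of the kernel equation has norm at most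
`N (1 + 1 / κ) / κ`, on every triangle `0 ≤ v ≤ X ≤ Z`. -/
theorem HasWindowBound.abs_integral_innerTerm_le {q : ℝ → ℝ} {N : ℝ} (hq : LocallyIntegrable q)
    (hN : HasWindowBound q N) {κ : ℝ} (hκ : 0 < κ) {D : ℝ × ℝ → ℝ} (hD : Continuous D)
    {M v X : ℝ} (hM : 0 ≤ M) (hv : 0 ≤ v) (hX : v ≤ X)
    (hDM : ∀ v' u : ℝ, 0 ≤ v' → v' ≤ u → u ≤ X → |D (v', u)| ≤ M * Real.exp (κ * (v' + u))) :
    |∫ u in v..X, innerTerm q D v u| ≤ M * (N * (1 + 1 / κ) / κ) * Real.exp (κ * (v + X)) := by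
  have hN0 := hN.nonneg
  calc |∫ u in v..X, innerTerm q D v u| ≤ ∫ u in v..X, |innerTerm q D v u| :=
        intervalIntegral.abs_integral_le_integral_abs hX
    _ ≤ ∫ u in v..X, M * (N * (1 + 1 / κ)) * Real.exp (κ * (v + u)) := by
        refine intervalIntegral.integral_mono_on hX ?_
          (Continuous.intervalIntegrable (by fun_prop) _ _) fun u hu => ?_
        · exact (((continuous_innerTerm hq hD).comp
            (by fun_prop : Continuous fun u : ℝ => (v, u))).abs).intervalIntegrable _ _
        · exact hN.abs_innerTerm_le hq hκ hD hM hv hu.1 fun v' h0 h1 => hDM v' u h0 h1 hu.2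
    _ = M * (N * (1 + 1 / κ)) * ∫ u in v..X, Real.exp (κ * (v + u)) :=
        intervalIntegral.integral_const_mul _ _
    _ ≤ M * (N * (1 + 1 / κ)) * (Real.exp (κ * (v + X)) / κ) := by
        gcongr
        exact integral_exp_mul_le hκ v X
    _ = _ := by ring

theorem HasWindowBound.abs_integral_le {q : ℝ → ℝ} {N : ℝ} (hq : LocallyIntegrable q)
    (hN : HasWindowBound q N) {κ : ℝ} (hκ : 0 < κ) {v X : ℝ} (hv : 0 ≤ v) (hX : v ≤ X) :
    |∫ u in v..X, q u| ≤ N * (1 + 1 / κ) * Real.exp (κ * (v + X)) := by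
  have hqa : LocallyIntegrable fun t => |q t| := hq.abs_real
  have hN0 := hN.nonneg
  calc |∫ u in v..X, q u| ≤ ∫ u in v..X, |q u| := intervalIntegral.abs_integral_le_integral_abs hX
    _ ≤ ∫ u in v..X, Real.exp (κ * (v + X)) * (Real.exp (-κ * (u - v)) * |q u|) := by
        refine intervalIntegral.integral_mono_on hX
          (LocallyIntegrable.intervalIntegrable_real hqa _ _)
          ((intervalIntegrable_mul_continuous hqa (by fun_prop) _ _).const_mul _) fun u hu => ?_
        rw [← mul_assoc, ← Real.exp_add]
        refine le_mul_of_one_le_left (abs_nonneg _) (Real.one_le_exp ?_)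
        nlinarith [hu.1, hu.2]
    _ = Real.exp (κ * (v + X)) * ∫ u in v..X, (Real.exp (-κ * (u - v)) * |q u|) :=
        intervalIntegral.integral_const_mul _ _
    _ ≤ Real.exp (κ * (v + X)) * (N * (1 + 1 / κ)) := by
        gcongr
        exact hN.integral_exp_le hq hκ hv hX
    _ = _ := by ring

/-! ### Existence and uniqueness of the kernel -/

/-- A weight for which the integral operator of the kernel equation is a contraction. -/
theorem exists_weight {N : ℝ} (hN : 0 ≤ N) : ∃ κ : ℝ, 0 < κ ∧ N * (1 + 1 / κ) / κ < 1 := by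
  have hκ : (0 : ℝ) < 2 * N + 2 := by positivity
  refine ⟨2 * N + 2, hκ, ?_⟩
  rw [div_lt_one hκ]
  have : 1 / (2 * N + 2) ≤ 1 := by rw [div_le_one hκ]; linarith
  nlinarith

/-- Solutions of the kernel equation are unique: on a triangle, the weighted supremum of the
difference of two solutions is at most a fraction of itself when the weight is strong enough. -/
theorem IsCharacteristicKernel.eq {q : ℝ → ℝ} {N : ℝ} (hq : LocallyIntegrable q)
    (hN : HasWindowBound q N) {B₁ B₂ : ℝ × ℝ → ℝ} (h₁ : IsCharacteristicKernel q B₁)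
    (h₂ : IsCharacteristicKernel q B₂) {v X : ℝ} (hv : 0 ≤ v) (hX : v ≤ X) :
    B₁ (v, X) = B₂ (v, X) := by
  have hN0 := hN.nonneg
  obtain ⟨κ, hκ, hρ⟩ := exists_weight hN0
  set T : Set (ℝ × ℝ) := {p | 0 ≤ p.1 ∧ p.1 ≤ p.2 ∧ p.2 ≤ X}
  have hTc : IsCompact T := by
    refine (isCompact_Icc (a := (0 : ℝ)) (b := X)).prod (isCompact_Icc (a := (0 : ℝ)) (b := X))
      |>.of_isClosed_subset ?_ ?_
    · exact (isClosed_le continuous_const continuous_fst).inter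
        ((isClosed_le continuous_fst continuous_snd).inter
          (isClosed_le continuous_snd continuous_const))
    · rintro ⟨a, b⟩ ⟨h0, h1, h2⟩
      exact ⟨⟨h0, h1.trans h2⟩, ⟨h0.trans h1, h2⟩⟩
  have hDc : Continuous (B₁ - B₂) := h₁.continuous.sub h₂.continuous
  obtain ⟨P, hP, hmax⟩ := hTc.exists_isMaxOn ⟨(v, X), hv, hX, le_rfl⟩
    (f := fun p => |(B₁ - B₂) p| * Real.exp (-κ * (p.1 + p.2))) (by fun_prop)
  set M := |(B₁ - B₂) P| * Real.exp (-κ * (P.1 + P.2)) with hM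
  have hM0 : 0 ≤ M := by positivity
  have hbound : ∀ p ∈ T, |(B₁ - B₂) p| ≤ M * Real.exp (κ * (p.1 + p.2)) := by
    intro p hp
    have : |(B₁ - B₂) p| * Real.exp (-κ * (p.1 + p.2)) ≤ M := hmax hp
    calc |(B₁ - B₂) p|
        = |(B₁ - B₂) p| * Real.exp (-κ * (p.1 + p.2)) * Real.exp (κ * (p.1 + p.2)) := by
          rw [mul_assoc, ← Real.exp_add]; simp
      _ ≤ _ := by gcongr
  have hPle : |(B₁ - B₂) P| ≤ M * (N * (1 + 1 / κ) / κ) * Real.exp (κ * (P.1 + P.2)) := by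
    have e : (B₁ - B₂) P = - ∫ u in P.1..P.2, innerTerm q (B₁ - B₂) P.1 u := by
      rw [← integral_kernel_sub hq h₁.continuous h₂.continuous,
        ← h₁.equation _ _ hP.1 hP.2.1, ← h₂.equation _ _ hP.1 hP.2.1]
      rfl
    rw [e, abs_neg]
    exact hN.abs_integral_innerTerm_le hq hκ hDc hM0 hP.1 hP.2.1 fun v' u h0 h1 h2 =>
      hbound (v', u) ⟨h0, h1, h2.trans hP.2.2⟩
  have hMle : M ≤ M * (N * (1 + 1 / κ) / κ) := by
    calc M ≤ M * (N * (1 + 1 / κ) / κ) * Real.exp (κ * (P.1 + P.2))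
          * Real.exp (-κ * (P.1 + P.2)) := by
          nth_rewrite 1 [hM]
          gcongr
      _ = _ := by rw [mul_assoc, ← Real.exp_add]; simp
  have hMz : M = 0 := by nlinarith
  have := hbound (v, X) ⟨hv, hX, le_rfl⟩
  rw [hMz, zero_mul] at this
  exact sub_eq_zero.1 (abs_nonpos_iff.1 this)

/-- Existence for the kernel equation, with an exponential bound: the integral operator is a
contraction of the bounded continuous functions after conjugation by `exp (κ (v + X))`. -/
theorem exists_isCharacteristicKernel {q : ℝ → ℝ} {N : ℝ} (hq : LocallyIntegrable q)
    (hN : HasWindowBound q N) {κ : ℝ} (hκ : 0 < κ) (hρ : N * (1 + 1 / κ) / κ < 1) :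
    ∃ B, IsCharacteristicKernel q B ∧
      ∃ M : ℝ, 0 ≤ M ∧ ∀ v X : ℝ, 0 ≤ v → v ≤ X → |B (v, X)| ≤ M * Real.exp (κ * (v + X)) := by
  have hN0 := hN.nonneg
  -- `(V p, Y p)` is `p` clamped to the region `0 ≤ v ≤ X`
  let V : ℝ × ℝ → ℝ := fun p => max p.1 0
  let Y : ℝ × ℝ → ℝ := fun p => max p.2 (V p)
  have hVc : Continuous V := by fun_prop
  have hYc : Continuous Y := by fun_prop
  have hV0 (p) : 0 ≤ V p := le_max_right _ _
  have hVY (p) : V p ≤ Y p := le_max_right _ _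
  let w : ℝ × ℝ → ℝ := fun p => Real.exp (κ * (p.1 + p.2))
  let E : BoundedContinuousFunction (ℝ × ℝ) ℝ → ℝ × ℝ → ℝ := fun f p => w p * f p
  have hE (f) : Continuous (E f) := by
    have := f.continuous
    simp only [E, w]
    fun_prop
  have hEle (f : BoundedContinuousFunction (ℝ × ℝ) ℝ) (v u : ℝ) :
      |E f (v, u)| ≤ ‖f‖ * Real.exp (κ * (v + u)) := by
    simp only [E, w, abs_mul, Real.abs_exp]
    rw [mul_comm]
    gcongr
    exact f.norm_coe_le_norm _
  let Φ₀ : BoundedContinuousFunction (ℝ × ℝ) ℝ → ℝ × ℝ → ℝ := fun f p =>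
    Real.exp (-κ * (V p + Y p)) * ∫ u in V p..Y p, (q u - innerTerm q (E f) (V p) u)
  have hΦc (f) : Continuous (Φ₀ f) := by
    have h1 := (continuous_integral_innerTerm hq (hE f)).comp (hVc.prodMk hYc)
    have h2 : Continuous fun p => ∫ u in V p..Y p, q u := by
      have h := intervalIntegral.continuous_primitive
        (fun a b => hq.intervalIntegrable_real a b) 0
      refine ((h.comp hYc).sub (h.comp hVc)).congr fun p => ?_
      exact intervalIntegral.integral_interval_sub_left (hq.intervalIntegrable_real _ _)
        (hq.intervalIntegrable_real _ _)
    simp only [Φ₀, integral_kernel_eq hq (hE f)]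
    exact (by fun_prop : Continuous fun p => Real.exp (-κ * (V p + Y p))).mul (h2.sub h1)
  have hinner (f) (p) : |∫ u in V p..Y p, innerTerm q (E f) (V p) u|
      ≤ ‖f‖ * (N * (1 + 1 / κ) / κ) * Real.exp (κ * (V p + Y p)) :=
    hN.abs_integral_innerTerm_le hq hκ (hE f) (norm_nonneg f) (hV0 p) (hVY p)
      fun v' u _ _ _ => hEle f v' u
  have hcancel (p) (C : ℝ) :
      Real.exp (-κ * (V p + Y p)) * (C * Real.exp (κ * (V p + Y p))) = C := by
    rw [mul_left_comm, ← Real.exp_add]; simp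
  have hΦb (f) (p) : ‖Φ₀ f p‖ ≤ N * (1 + 1 / κ) + ‖f‖ * (N * (1 + 1 / κ) / κ) := by
    simp only [Φ₀, integral_kernel_eq hq (hE f), norm_mul, Real.norm_eq_abs, Real.abs_exp]
    calc _ ≤ Real.exp (-κ * (V p + Y p)) * ((N * (1 + 1 / κ)
          + ‖f‖ * (N * (1 + 1 / κ) / κ)) * Real.exp (κ * (V p + Y p))) := by
          gcongr
          refine (abs_sub _ _).trans ?_
          rw [add_mul]
          exact add_le_add (hN.abs_integral_le hq hκ (hV0 p) (hVY p)) (hinner f p)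
      _ = _ := hcancel p _
  let Φ : BoundedContinuousFunction (ℝ × ℝ) ℝ → BoundedContinuousFunction (ℝ × ℝ) ℝ := fun f =>
    BoundedContinuousFunction.ofNormedAddCommGroup (Φ₀ f) (hΦc f) _ (hΦb f)
  have hρ0 : 0 ≤ N * (1 + 1 / κ) / κ := by positivity
  have hΦ : ContractingWith (⟨N * (1 + 1 / κ) / κ, hρ0⟩ : ℝ≥0) Φ := by
    refine ⟨by exact_mod_cast hρ, LipschitzWith.of_dist_le_mul fun f g => ?_⟩
    rw [BoundedContinuousFunction.dist_le (by positivity)]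
    intro p
    have e : Φ f p - Φ g p = Real.exp (-κ * (V p + Y p)) *
        (- ∫ u in V p..Y p, innerTerm q (E (f - g)) (V p) u) := by
      have : E (f - g) = E f - E g := by ext p; simp [E, mul_sub]
      rw [this, ← integral_kernel_sub hq (hE f) (hE g)]
      exact (mul_sub _ _ _).symm
    rw [Real.dist_eq, e, abs_mul, abs_neg, Real.abs_exp]
    calc _ ≤ Real.exp (-κ * (V p + Y p)) * (‖f - g‖ * (N * (1 + 1 / κ) / κ)
          * Real.exp (κ * (V p + Y p))) := by
          gcongr
          exact hinner _ p
      _ = _ := by rw [hcancel, mul_comm, ← dist_eq_norm]; rfl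
  let f := hΦ.fixedPoint Φ
  have hf : Φ f = f := hΦ.fixedPoint_isFixedPt
  refine ⟨E f, ⟨hE f, fun v X hv hX => ?_⟩, ‖f‖, norm_nonneg _, fun v X _ _ => hEle f v X⟩
  have h := DFunLike.congr_fun hf (v, X)
  have hV : V (v, X) = v := max_eq_left hv
  have hY : Y (v, X) = X := by simp only [Y, hV]; exact max_eq_left hX
  have h' : Real.exp (-κ * (v + X)) * ∫ u in v..X, (q u - innerTerm q (E f) v u) = f (v, X) := by
    rw [← h]
    simp only [Φ, Φ₀, BoundedContinuousFunction.coe_ofNormedAddCommGroup, hV, hY]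
  change Real.exp (κ * (v + X)) * f (v, X) = _
  rw [← h', ← mul_assoc, ← Real.exp_add]
  simp

/-- Beyond the threshold `2 max (√(2N), e N)` the kernel equation is a contraction. -/
theorem weight_lt_one {N κ : ℝ} (hN : 0 ≤ N)
    (hκ : 2 * max (Real.sqrt (2 * N)) (Real.exp 1 * N) < κ) :
    0 < κ ∧ N * (1 + 1 / κ) / κ < 1 := by
  have h1 : 2 * Real.sqrt (2 * N) < κ := by
    linarith [le_max_left (Real.sqrt (2 * N)) (Real.exp 1 * N)]
  have h2 : 2 * (Real.exp 1 * N) < κ := by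
    linarith [le_max_right (Real.sqrt (2 * N)) (Real.exp 1 * N)]
  have hs := Real.sqrt_nonneg (2 * N)
  have hκ0 : 0 < κ := by linarith
  refine ⟨hκ0, ?_⟩
  -- `N (1 + 1/κ) / κ = N/κ + N/κ²`, where `N/κ ≤ 1/4` and `N/κ² < 1/8`
  have h3 : 8 * N < κ ^ 2 := by
    have := Real.sq_sqrt (by positivity : 0 ≤ 2 * N)
    nlinarith
  have h4 : 4 * N ≤ κ := by
    have : 2 ≤ Real.exp 1 := by have := Real.add_one_le_exp (1 : ℝ); linarith
    nlinarith
  have : N * (1 + 1 / κ) / κ = (N * κ + N) / κ ^ 2 := by field_simp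
  rw [this, div_lt_one (by positivity)]
  nlinarith

/-! ### The Volterra equation and the boundary derivative -/

theorem IsCharacteristicKernel.isVolterraKernel {q : ℝ → ℝ} (hq : LocallyIntegrable q)
    {B : ℝ × ℝ → ℝ} (hB : IsCharacteristicKernel q B) :
    IsVolterraKernel q fun x y => q x - innerTerm q B y x := by
  refine ⟨?_, fun x y hy hx => ?_⟩
  · have : Continuous fun p : ℝ × ℝ => -innerTerm q B p.2 p.1 :=
      ((continuous_innerTerm hq hB.continuous).comp continuous_swap).neg
    refine this.continuousOn.congr fun p _ => ?_
    simp
  · rw [innerTerm_eq]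
    congr 1
    refine intervalIntegral.integral_congr fun s hs => ?_
    rw [uIcc_of_le hy] at hs
    simp only [hB.equation s x hs.1 (hs.2.trans hx)]

/-- A solution `K` of the Volterra equation is the `X`-derivative of a solution of the kernel
equation. -/
theorem IsVolterraKernel.exists_isCharacteristicKernel {q : ℝ → ℝ} (hq : LocallyIntegrable q)
    {K : ℝ → ℝ → ℝ} (hK : IsVolterraKernel q K) :
    ∃ B, IsCharacteristicKernel q B ∧
      ∀ v u : ℝ, 0 ≤ v → v ≤ u → K u v = q u - innerTerm q B v u := by
  let C : ℝ × ℝ → ℝ := fun p => K (max p.2 (max p.1 0)) (max p.1 0) - q (max p.2 (max p.1 0))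
  have hC : Continuous C := by
    have := hK.continuousOn.comp_continuous
      (f := fun p : ℝ × ℝ => (max p.2 (max p.1 0), max p.1 0)) (by fun_prop)
      (fun p => ⟨le_max_right _ _, le_max_right _ _⟩)
    exact this
  have hCK {v u : ℝ} (hv : 0 ≤ v) (hu : v ≤ u) : q u + C (v, u) = K u v := by
    simp only [C, max_eq_left hv, max_eq_left hu]; ring
  let B : ℝ × ℝ → ℝ := fun p => ∫ u in p.1..p.2, (q u + C (p.1, u))
  have hCi (v a b : ℝ) : IntervalIntegrable (fun u => C (v, u)) volume a b :=
    Continuous.intervalIntegrable (by fun_prop) _ _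
  have hBc : Continuous B := by
    have h1 := intervalIntegral.continuous_primitive (fun a b => hq.intervalIntegrable_real a b) 0
    have h2 := intervalIntegral.continuous_parametric_primitive_of_continuous (μ := volume)
      (a₀ := 0) (f := fun v u => C (v, u)) hC
    have h3 : Continuous fun p : ℝ × ℝ => ∫ u in (0 : ℝ)..p.1, C (p.1, u) :=
      h2.comp (by fun_prop : Continuous fun p : ℝ × ℝ => (p.1, p.1))
    refine (((h1.comp continuous_snd).sub (h1.comp continuous_fst)).add (h2.sub h3)).congr
      fun p => ?_
    simp only [B]
    rw [intervalIntegral.integral_add (hq.intervalIntegrable_real _ _) (hCi _ _ _),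
      ← intervalIntegral.integral_interval_sub_left (hq.intervalIntegrable_real 0 _)
        (hq.intervalIntegrable_real 0 _),
      ← intervalIntegral.integral_interval_sub_left (hCi _ 0 _) (hCi _ 0 _)]
    rfl
  have hBK {v u : ℝ} (hv : 0 ≤ v) (hu : v ≤ u) : B (v, u) = ∫ u' in v..u, K u' v := by
    refine intervalIntegral.integral_congr fun u' hu' => ?_
    rw [uIcc_of_le hu] at hu'
    exact hCK hv hu'.1
  have hKB {v u : ℝ} (hv : 0 ≤ v) (hu : v ≤ u) : K u v = q u - innerTerm q B v u := by
    rw [hK.equation u v hv hu, innerTerm_eq]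
    congr 1
    refine intervalIntegral.integral_congr fun s hs => ?_
    rw [uIcc_of_le hv] at hs
    simp only [hBK hs.1 (hs.2.trans hu)]
  refine ⟨B, ⟨hBc, fun v X hv hX => ?_⟩, fun v u hv hu => hKB hv hu⟩
  rw [hBK hv hX]
  refine intervalIntegral.integral_congr fun u hu => ?_
  rw [uIcc_of_le hX] at hu
  exact hKB hv hu.1

/-- Null sets are invariant under dilations. -/
theorem ae_comp_mul_left {P : ℝ → Prop} (h : ∀ᵐ y, P y) {c : ℝ} (hc : c ≠ 0) :
    ∀ᵐ s : ℝ, P (c * s) := by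
  rw [ae_iff] at h ⊢
  have := Real.volume_preimage_mul_left hc {y | ¬ P y}
  rw [h, mul_zero] at this
  exact this

/-- The contribution of the continuous part of `A` to the boundary derivative: after rescaling, the
integral is `x` times a function continuous at `0`. -/
theorem hasDerivAt_integral_symmetric {g : ℝ × ℝ → ℝ} (hg : Continuous g) (c : ℝ) :
    HasDerivAt (fun x : ℝ => ∫ u in (c - x / 2)..(c + x / 2), g (c - x / 2, u)) (g (c, c)) 0 := by
  let γ : ℝ → ℝ := fun x => ∫ θ in (0 : ℝ)..1, g (c - x / 2, x * θ + (c - x / 2))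
  have hγ : Continuous γ := intervalIntegral.continuous_parametric_intervalIntegral_of_continuous'
    (f := fun x θ => g (c - x / 2, x * θ + (c - x / 2))) (by unfold Function.uncurry; fun_prop) 0 1
  have e (x : ℝ) : ∫ u in (c - x / 2)..(c + x / 2), g (c - x / 2, u) = x * γ x := by
    have := intervalIntegral.smul_integral_comp_mul_add (a := 0) (b := 1)
      (fun u => g (c - x / 2, u)) x (c - x / 2)
    rw [smul_eq_mul] at this
    simp only [γ]
    rw [this]
    congr 1 <;> ring
  simp only [e]
  rw [hasDerivAt_iff_tendsto_slope]
  have h0 : γ 0 = g (c, c) := by simp [γ]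
  rw [← h0]
  refine (hγ.tendsto 0).mono_left nhdsWithin_le_nhds |>.congr' ?_
  filter_upwards [self_mem_nhdsWithin] with x hx
  have hx : x ≠ 0 := hx
  simp [slope, hx]

/-- The boundary derivative of the solution `w = -B / 2` of the Goursat problem exists at every
Lebesgue point of `q`. -/
theorem IsCharacteristicKernel.ae_hasDerivWithinAt {q : ℝ → ℝ} (hq : LocallyIntegrable q)
    {B : ℝ × ℝ → ℝ} (hB : IsCharacteristicKernel q B) {w : ℝ × ℝ → ℝ}
    (hw : ∀ x s : ℝ, 0 ≤ x → x ≤ s → w (x, s) = -(1 / 2) * B ((s - x) / 2, (s + x) / 2)) :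
    ∀ᵐ s ∂(volume.restrict (Ioi (0 : ℝ))), HasDerivWithinAt (fun x => w (x, s))
      (-(1 / 2) * (q (s / 2) - innerTerm q B (s / 2) (s / 2))) (Ici 0) 0 := by
  rw [ae_restrict_iff' measurableSet_Ioi]
  filter_upwards [ae_comp_mul_left (LocallyIntegrable.ae_hasDerivAt_integral hq) (c := 1 / 2)
    (by norm_num)] with s hs hs0
  have hs0 : 0 < s := hs0
  rw [show 1 / 2 * s = s / 2 by ring] at hs
  have hQ : HasDerivAt (fun x : ℝ => (∫ u in (0 : ℝ)..(s / 2 + x / 2), q u)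
      - ∫ u in (0 : ℝ)..(s / 2 - x / 2), q u) (q (s / 2)) 0 := by
    have a1 : HasDerivAt (fun x : ℝ => s / 2 + x / 2) (1 / 2) 0 :=
      ((hasDerivAt_id (0 : ℝ)).div_const 2).const_add _
    have a2 : HasDerivAt (fun x : ℝ => s / 2 - x / 2) (-(1 / 2)) 0 :=
      ((hasDerivAt_id (0 : ℝ)).div_const 2).const_sub _
    have b1 := HasDerivAt.comp (0 : ℝ) (h := fun x : ℝ => s / 2 + x / 2)
      (h₂ := fun y => ∫ u in (0 : ℝ)..y, q u) (h₂' := q (s / 2)) (by simpa using hs 0) a1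
    have b2 := HasDerivAt.comp (0 : ℝ) (h := fun x : ℝ => s / 2 - x / 2)
      (h₂ := fun y => ∫ u in (0 : ℝ)..y, q u) (h₂' := q (s / 2)) (by simpa using hs 0) a2
    exact (b1.sub b2).congr_deriv (by ring)
  have hI := hasDerivAt_integral_symmetric (continuous_innerTerm hq hB.continuous) (s / 2)
  refine (((hQ.sub hI).const_mul (-(1 / 2))).hasDerivWithinAt (s := Ici 0)).congr_of_eventuallyEq
    ?_ ?_
  · filter_upwards [self_mem_nhdsWithin, nhdsWithin_le_nhds (Iio_mem_nhds hs0)] with x hx hxs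
    have hx : 0 ≤ x := hx
    have hxs : x < s := hxs
    rw [hw x s hx hxs.le, hB.equation _ _ (by linarith) (by linarith),
      integral_kernel_eq hq hB.continuous]
    simp only [Pi.sub_apply]
    rw [intervalIntegral.integral_interval_sub_left (hq.intervalIntegrable_real _ _)
      (hq.intervalIntegrable_real _ _)]
    ring_nf
  · rw [hw 0 s le_rfl hs0.le, hB.equation _ _ (by linarith) (by linarith)]
    simp

/-! ### Absolutely continuous functions and weak derivatives -/

/-- Fubini's theorem on the triangle `a ≤ t ≤ x ≤ b`. -/
theorem integral_primitive_mul {𝕜 : Type*} [RCLike 𝕜] {f g : ℝ → 𝕜} {a b : ℝ} (hab : a ≤ b)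
    (hf : IntervalIntegrable f volume a b) (hg : IntervalIntegrable g volume a b) :
    ∫ x in a..b, (∫ t in a..x, f t) * g x = ∫ t in a..b, f t * ∫ x in t..b, g x := by
  have hF : IntegrableOn (Function.uncurry fun x t => {p : ℝ × ℝ | p.2 ≤ p.1}.indicator
      (fun p => f p.2 * g p.1) (x, t)) (uIoc a b ×ˢ uIoc a b) := by
    have h1 : IntegrableOn (fun p : ℝ × ℝ => f p.2 * g p.1) (uIoc a b ×ˢ uIoc a b) := by
      rw [IntegrableOn, Measure.volume_eq_prod, ← Measure.prod_restrict]
      have := hg.def'.mul_prod hf.def'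
      refine this.congr (Eventually.of_forall fun p => ?_)
      simp [mul_comm]
    exact h1.indicator (measurableSet_le measurable_snd measurable_fst)
  have hsw := intervalIntegral_intervalIntegral_swap hF
  calc _ = ∫ x in a..b, ∫ t in a..b, {p : ℝ × ℝ | p.2 ≤ p.1}.indicator
        (fun p => f p.2 * g p.1) (x, t) := by
        refine intervalIntegral.integral_congr fun x hx => ?_
        rw [uIcc_of_le hab] at hx
        rw [← intervalIntegral.integral_mul_const, ← intervalIntegral.integral_indicator hx]
        rfl
    _ = _ := hsw
    _ = _ := by
        rw [intervalIntegral.integral_of_le hab, intervalIntegral.integral_of_le hab]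
        refine setIntegral_congr_fun measurableSet_Ioc fun t ht => ?_
        rw [← intervalIntegral.integral_const_mul, intervalIntegral.integral_of_le hab,
          intervalIntegral.integral_of_le ht.2, ← integral_Icc_eq_integral_Ioc (x := t)]
        have : Icc t b = Ioc a b ∩ Ici t := by
          ext x; simp only [mem_Icc, mem_inter_iff, mem_Ioc, mem_Ici]
          exact ⟨fun h => ⟨⟨ht.1.trans_le h.1, h.2⟩, h.1⟩, fun h => ⟨h.2, h.1.2⟩⟩
        rw [this, ← setIntegral_indicator measurableSet_Ici]
        rfl

/-- Integration by parts for two absolutely continuous functions, given by their densities. -/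
theorem integral_mul_add_mul_of_primitive {𝕜 : Type*} [RCLike 𝕜] {f g F G : ℝ → 𝕜} {a b : ℝ}
    (hab : a ≤ b) (hf : IntervalIntegrable f volume a b) (hg : IntervalIntegrable g volume a b)
    (hF : ∀ x ∈ Icc a b, F x = F a + ∫ t in a..x, f t)
    (hG : ∀ x ∈ Icc a b, G x = G a + ∫ t in a..x, g t) :
    (∫ x in a..b, F x * g x) + ∫ x in a..b, f x * G x = F b * G b - F a * G a := by
  have hb : b ∈ Icc a b := ⟨hab, le_rfl⟩
  have cf : ContinuousOn (fun x => ∫ t in a..x, f t) (uIcc a b) :=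
    intervalIntegral.continuousOn_primitive_interval' hf left_mem_uIcc
  have i1 : IntervalIntegrable (fun x => (∫ t in a..x, f t) * g x) volume a b :=
    hg.continuousOn_mul cf
  have e1 : ∫ x in a..b, F x * g x
      = F a * (∫ x in a..b, g x) + ∫ t in a..b, f t * ∫ x in t..b, g x := by
    rw [← integral_primitive_mul hab hf hg, ← intervalIntegral.integral_const_mul,
      ← intervalIntegral.integral_add (hg.const_mul _) i1]
    refine intervalIntegral.integral_congr fun x hx => ?_
    rw [uIcc_of_le hab] at hx
    rw [hF x hx]; ring
  have cg : ContinuousOn (fun t => ∫ x in t..b, g x) (uIcc a b) := by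
    have := intervalIntegral.continuousOn_primitive_interval' hg.symm left_mem_uIcc
    rw [uIcc_comm] at this
    refine this.neg.congr fun t _ => ?_
    rw [intervalIntegral.integral_symm]
    rfl
  have i2 : IntervalIntegrable (fun t => f t * ∫ x in t..b, g x) volume a b :=
    hf.mul_continuousOn cg
  have e2 : ∫ x in a..b, f x * G x
      = (∫ x in a..b, f x) * G b - ∫ t in a..b, f t * ∫ x in t..b, g x := by
    rw [← intervalIntegral.integral_mul_const, ← intervalIntegral.integral_sub (hf.mul_const _) i2]
    refine intervalIntegral.integral_congr fun x hx => ?_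
    have hx' := hx
    rw [uIcc_of_le hab] at hx
    have : (∫ t in a..x, g t) + ∫ t in x..b, g t = ∫ t in a..b, g t :=
      intervalIntegral.integral_add_adjacent_intervals
        (hg.mono_set (uIcc_subset_uIcc_left hx'))
        (hg.mono_set (uIcc_subset_uIcc_right hx'))
    rw [hG x hx, hG b hb, ← this]; ring
  rw [e1, e2, hF b hb, hG b hb]
  ring

theorem eq_integral_deriv_of_contDiff {φ : ℝ → ℝ} (hφ : ContDiff ℝ ∞ φ) (a x : ℝ) :
    φ x = φ a + ∫ t in a..x, deriv φ t := by
  rw [intervalIntegral.integral_deriv_eq_sub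
    (fun t _ => (hφ.differentiable (by simp)).differentiableAt)
    ((hφ.continuous_deriv (by simp)).intervalIntegrable _ _)]
  ring

theorem eq_zero_left_of_tsupport_subset_Ioo {φ : ℝ → ℝ} {α β : ℝ} (h : tsupport φ ⊆ Ioo α β) :
    φ α = 0 := image_eq_zero_of_notMem_tsupport fun h' => lt_irrefl _ (h h').1

theorem eq_zero_right_of_tsupport_subset_Ioo {φ : ℝ → ℝ} {α β : ℝ} (h : tsupport φ ⊆ Ioo α β) :
    φ β = 0 := image_eq_zero_of_notMem_tsupport fun h' => lt_irrefl _ (h h').2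

theorem intervalIntegral_eq_integral_of_tsupport_subset {φ f : ℝ → ℝ} {α β : ℝ}
    (h : tsupport φ ⊆ Ioo α β) (hf : ∀ x, φ x = 0 → f x = 0) :
    ∫ x in α..β, f x = ∫ x, f x := by
  refine intervalIntegral.integral_eq_integral_of_support_subset fun x hx => ?_
  have := h (subset_tsupport φ fun h0 => hx (hf x h0))
  exact Ioo_subset_Ioc_self this

/-- A test function on `(α, β)` with mean zero is the derivative of a test function. -/
theorem exists_deriv_eq_of_integral_eq_zero {ψ : ℝ → ℝ} {α β : ℝ} (hαβ : α < β)
    (hψ : ContDiff ℝ ∞ ψ) (hs : HasCompactSupport ψ) (hsub : tsupport ψ ⊆ Ioo α β)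
    (h0 : ∫ x, ψ x = 0) :
    ∃ Ψ : ℝ → ℝ, ContDiff ℝ ∞ Ψ ∧ HasCompactSupport Ψ ∧ tsupport Ψ ⊆ Ioo α β ∧
      ∀ x, deriv Ψ x = ψ x := by
  obtain ⟨a, b, hab, haα, hbβ, hK⟩ : ∃ a b, a ≤ b ∧ α < a ∧ b < β ∧ tsupport ψ ⊆ Icc a b := by
    rcases (tsupport ψ).eq_empty_or_nonempty with he | hne
    · exact ⟨(α + β) / 2, (α + β) / 2, le_rfl, by linarith, by linarith, by simp [he]⟩
    · obtain ⟨a, ha⟩ := hs.exists_isLeast hne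
      obtain ⟨b, hb⟩ := hs.exists_isGreatest hne
      exact ⟨a, b, ha.2 hb.1, (hsub ha.1).1, (hsub hb.1).2, fun x hx => ⟨ha.2 hx, hb.2 hx⟩⟩
  have hψ0 {x : ℝ} (hx : x ∉ Icc a b) : ψ x = 0 :=
    image_eq_zero_of_notMem_tsupport fun h => hx (hK h)
  let Ψ : ℝ → ℝ := fun x => ∫ t in α..x, ψ t
  have hd (x) : HasDerivAt Ψ (ψ x) x :=
    intervalIntegral.integral_hasDerivAt_right (hψ.continuous.intervalIntegrable _ _)
      hψ.continuous.stronglyMeasurable.stronglyMeasurableAtFilter hψ.continuous.continuousAt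
  have hder : deriv Ψ = ψ := funext fun x => (hd x).deriv
  have hsupp : Function.support Ψ ⊆ Icc a b := by
    intro x hx
    by_contra hxab
    refine hx ?_
    rcases lt_or_ge x a with hxa | hxa
    · have : ∫ t in α..x, ψ t = ∫ t in α..x, (0 : ℝ) := by
        refine intervalIntegral.integral_congr fun t ht => hψ0 fun h => ?_
        have := (mem_uIcc.1 ht)
        rcases this with h' | h' <;> linarith [h.1]
      simpa using this
    · have hxb : b < x := by
        by_contra hle
        exact hxab ⟨hxa, not_lt.1 hle⟩
      have : ∫ t in α..x, ψ t = ∫ t, ψ t := by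
        refine intervalIntegral.integral_eq_integral_of_support_subset fun t ht => ?_
        have : t ∈ Icc a b := by
          by_contra h
          exact ht (hψ0 h)
        exact ⟨haα.trans_le this.1, this.2.trans hxb.le⟩
      simpa [h0] using this
  have hts : tsupport Ψ ⊆ Icc a b := closure_minimal hsupp isClosed_Icc
  refine ⟨Ψ, ?_, isCompact_Icc.of_isClosed_subset (isClosed_tsupport _) hts,
    hts.trans (Icc_subset_Ioo haα hbβ), fun x => (hd x).deriv⟩
  rw [contDiff_infty_iff_deriv]
  exact ⟨fun x => (hd x).differentiableAt, hder ▸ hψ⟩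

/-- If `g' = h` on `(α, β)` in the sense of distributions and `g` is continuous up to the end
points, then `g` is a primitive of `h`. -/
theorem sub_eq_integral_of_weak_deriv {g h : ℝ → ℝ} {α β : ℝ} (hαβ : α ≤ β)
    (hg : ContinuousOn g (Icc α β)) (hh : IntervalIntegrable h volume α β)
    (H : ∀ φ : ℝ → ℝ, ContDiff ℝ ∞ φ → HasCompactSupport φ → tsupport φ ⊆ Ioo α β →
      (∫ x in α..β, g x * deriv φ x) + ∫ x in α..β, h x * φ x = 0) :
    g β - g α = ∫ x in α..β, h x := by
  rcases hαβ.eq_or_lt with rfl | hlt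
  · simp
  -- `f` has vanishing weak derivative, so it is constant
  let f : ℝ → ℝ := fun x => g x - ∫ t in α..x, h t
  have hp : ContinuousOn (fun x => ∫ t in α..x, h t) (Icc α β) := by
    have := intervalIntegral.continuousOn_primitive_interval' hh left_mem_uIcc
    rwa [uIcc_of_le hαβ] at this
  have hf : ContinuousOn f (Icc α β) := hg.sub hp
  have key : ∀ φ : ℝ → ℝ, ContDiff ℝ ∞ φ → HasCompactSupport φ → tsupport φ ⊆ Ioo α β →
      ∫ x in α..β, f x * deriv φ x = 0 := by
    intro φ h1 h2 h3
    have hdφ := h1.continuous_deriv (n := ∞) (by simp)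
    have e := integral_mul_add_mul_of_primitive hαβ hh (hdφ.intervalIntegrable α β)
      (F := fun x => ∫ t in α..x, h t) (G := φ) (fun x _ => by simp)
      (fun x _ => eq_integral_deriv_of_contDiff h1 α x)
    rw [eq_zero_left_of_tsupport_subset_Ioo h3, eq_zero_right_of_tsupport_subset_Ioo h3] at e
    simp only [f, sub_mul]
    rw [intervalIntegral.integral_sub]
    · linarith [H φ h1 h2 h3]
    · exact (((uIcc_of_le hαβ).symm ▸ hg).mul hdφ.continuousOn).intervalIntegrable
    · exact (((uIcc_of_le hαβ).symm ▸ hp).mul hdφ.continuousOn).intervalIntegrable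
  -- a normalized bump function in the middle of the interval
  obtain ⟨ρ, hρ1, hρ2, hρ3, hρ4⟩ : ∃ ρ : ℝ → ℝ, ContDiff ℝ ∞ ρ ∧ HasCompactSupport ρ ∧
      tsupport ρ ⊆ Ioo α β ∧ ∫ x, ρ x = 1 := by
    let c : ContDiffBump ((α + β) / 2) := ⟨(β - α) / 8, (β - α) / 4, by linarith, by linarith⟩
    refine ⟨c.normed volume, c.contDiff_normed, c.hasCompactSupport_normed, ?_, c.integral_normed⟩
    rw [c.tsupport_normed_eq, Real.closedBall_eq_Icc]
    intro x hx
    have h1 := hx.1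
    have h2 := hx.2
    simp only [c] at h1 h2
    exact ⟨by linarith, by linarith⟩
  let c := ∫ x in α..β, f x * ρ x
  have hfi {φ : ℝ → ℝ} (hφ : Continuous φ) :
      IntervalIntegrable (fun x => f x * φ x) volume α β :=
    (((uIcc_of_le hαβ).symm ▸ hf).mul hφ.continuousOn).intervalIntegrable
  have hae : ∀ᵐ x ∂(volume : Measure ℝ), x ∈ Ioo α β → f x - c = 0 := by
    refine isOpen_Ioo.ae_eq_zero_of_integral_contDiff_smul_eq_zero ?_ fun φ h1 h2 h3 => ?_
    · exact ((hf.mono Ioo_subset_Icc_self).sub continuousOn_const).locallyIntegrableOn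
        measurableSet_Ioo
    · set m := ∫ x, φ x with hm
      let ψ : ℝ → ℝ := fun x => φ x - m * ρ x
      have hψ1 : ContDiff ℝ ∞ ψ := h1.sub (contDiff_const.mul hρ1)
      have hsupp : tsupport ψ ⊆ tsupport φ ∪ tsupport ρ := by
        refine closure_minimal (fun x hx => ?_) ((isClosed_tsupport _).union (isClosed_tsupport _))
        by_contra hn
        simp only [mem_union, not_or] at hn
        exact hx (by simp [ψ, image_eq_zero_of_notMem_tsupport hn.1,
          image_eq_zero_of_notMem_tsupport hn.2])
      have hψ2 : HasCompactSupport ψ :=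
        (IsCompact.union h2 hρ2).of_isClosed_subset (isClosed_tsupport _) hsupp
      have hψ4 : ∫ x, ψ x = 0 := by
        simp only [ψ]
        rw [integral_sub (h1.continuous.integrable_of_hasCompactSupport h2)
          ((hρ1.continuous.integrable_of_hasCompactSupport hρ2).const_mul _),
          integral_const_mul, hρ4]
        simp [hm]
      obtain ⟨Ψ, a1, a2, a3, a4⟩ := exists_deriv_eq_of_integral_eq_zero hlt hψ1 hψ2
        (hsupp.trans (union_subset h3 hρ3)) hψ4
      have e := key Ψ a1 a2 a3
      simp only [a4, ψ, mul_sub] at e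
      rw [intervalIntegral.integral_sub (hfi h1.continuous)
        (hfi (φ := fun x => m * ρ x) (by have := hρ1.continuous; fun_prop))] at e
      simp only [mul_left_comm _ m] at e
      rw [intervalIntegral.integral_const_mul] at e
      rw [← intervalIntegral_eq_integral_of_tsupport_subset h3
        (fun x hx => by simp [hx])]
      simp only [smul_eq_mul, mul_sub]
      have hm' : m = ∫ x in α..β, φ x :=
        (intervalIntegral_eq_integral_of_tsupport_subset h3 fun x hx => hx).symm
      rw [intervalIntegral.integral_sub, intervalIntegral.integral_mul_const, ← hm']
      · simp only [mul_comm (φ _)]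
        exact e
      · simpa only [mul_comm (φ _)] using hfi h1.continuous
      · exact (h1.continuous.mul continuous_const).intervalIntegrable _ _
  have hEq : EqOn f (fun _ => c) (Icc α β) := by
    refine Measure.eqOn_Icc_of_ae_eq volume hlt.ne ?_ hf continuousOn_const
    rw [← restrict_Ioo_eq_restrict_Icc]
    refine (ae_restrict_iff' measurableSet_Ioo).2 ?_
    filter_upwards [hae] with x hx hx'
    exact sub_eq_zero.1 (hx hx')
  have e1 : f α = c := hEq ⟨le_rfl, hαβ⟩
  have e2 : f β = c := hEq ⟨hαβ, le_rfl⟩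
  simp only [f, intervalIntegral.integral_same] at e1 e2
  linarith

/-! ### From the Goursat problem to the kernel equation -/

/-- The passage from characteristic coordinates `(v, X)` to `(x, s) = (X - v, X + v)`. -/
def charMap (z : ℝ × ℝ) : ℝ × ℝ := (z.2 - z.1, z.2 + z.1)

theorem continuous_charMap : Continuous charMap := by unfold charMap; fun_prop

theorem charMap_half (x s : ℝ) : charMap ((s - x) / 2, (s + x) / 2) = (x, s) := by
  simp only [charMap]; ext <;> simp <;> ring

/-- `charMap` as a linear equivalence. -/
noncomputable def charEquiv : (ℝ × ℝ) ≃ₗ[ℝ] (ℝ × ℝ) where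
  toFun := charMap
  invFun p := ((p.2 - p.1) / 2, (p.2 + p.1) / 2)
  map_add' z w := by simp only [charMap]; ext <;> simp <;> ring
  map_smul' c z := by simp only [charMap]; ext <;> simp [mul_sub, mul_add]
  left_inv z := by simp only [charMap]; ext <;> simp
  right_inv p := by simp only [charMap]; ext <;> simp <;> ring

/-- The change to characteristic coordinates multiplies integrals by a nonzero constant, whose
value is irrelevant for the homogeneous weak equation. -/
theorem integral_comp_charMap_eq_zero_iff (f : ℝ × ℝ → ℝ) :
    ∫ z, f (charMap z) = 0 ↔ ∫ p, f p = 0 := by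
  have hdet : LinearMap.det (charEquiv : (ℝ × ℝ) →ₗ[ℝ] (ℝ × ℝ)) ≠ 0 :=
    (LinearEquiv.isUnit_det' charEquiv).ne_zero
  have hmap := Measure.map_linearMap_addHaar_eq_smul_addHaar (volume : Measure (ℝ × ℝ)) hdet
  have hemb : MeasurableEmbedding (charEquiv : (ℝ × ℝ) → (ℝ × ℝ)) :=
    charEquiv.toContinuousLinearEquiv.toHomeomorph.measurableEmbedding
  have h1 : ∫ z, f (charMap z) = ∫ p, f p ∂(Measure.map charEquiv volume) :=
    (hemb.integral_map f).symm
  have h2 : Measure.map charEquiv (volume : Measure (ℝ × ℝ)) = _ := hmap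
  rw [h1, h2, integral_smul_measure]
  simp only [smul_eq_mul, mul_eq_zero, ENNReal.toReal_eq_zero_iff]
  constructor
  · rintro (h | h)
    · rcases h with h | h
      · rw [ENNReal.ofReal_eq_zero] at h
        exact absurd h (not_le.2 (abs_pos.2 (inv_ne_zero hdet)))
      · exact absurd h ENNReal.ofReal_ne_top
    · exact h
  · exact Or.inr

/-- The first derivative of `φ` in the direction `∂_v = ∂_s - ∂_x`, at `charMap z`. -/
noncomputable def charDeriv (φ : ℝ × ℝ → ℝ) (z : ℝ × ℝ) : ℝ := fderiv ℝ φ (charMap z) (-1, 1)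

/-- The mixed second derivative `∂_X ∂_v φ`, at `charMap z`. -/
noncomputable def charDeriv₂ (φ : ℝ × ℝ → ℝ) (z : ℝ × ℝ) : ℝ :=
  fderiv ℝ (fderiv ℝ φ) (charMap z) (1, 1) (-1, 1)

section Derivatives

variable {φ : ℝ × ℝ → ℝ}

theorem hasDerivAt_charMap_fst (v X : ℝ) :
    HasDerivAt (fun v => charMap (v, X)) ((-1, 1) : ℝ × ℝ) v :=
  ((hasDerivAt_id v).const_sub X).prodMk ((hasDerivAt_id v).const_add X)

theorem hasDerivAt_charMap_snd (v X : ℝ) :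
    HasDerivAt (fun X => charMap (v, X)) ((1, 1) : ℝ × ℝ) X :=
  ((hasDerivAt_id X).sub_const v).prodMk ((hasDerivAt_id X).add_const v)

theorem hasDerivAt_comp_charMap (hφ : ContDiff ℝ ∞ φ) (v X : ℝ) :
    HasDerivAt (fun v => φ (charMap (v, X))) (charDeriv φ (v, X)) v :=
  ((hφ.differentiable (by simp)) _).hasFDerivAt.comp_hasDerivAt v (hasDerivAt_charMap_fst v X)

theorem contDiff_fderiv_infty (hφ : ContDiff ℝ ∞ φ) : ContDiff ℝ ∞ (fderiv ℝ φ) :=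
  hφ.fderiv_right (by simp)

theorem hasDerivAt_charDeriv (hφ : ContDiff ℝ ∞ φ) (v X : ℝ) :
    HasDerivAt (fun X => charDeriv φ (v, X)) (charDeriv₂ φ (v, X)) X := by
  have h := (((contDiff_fderiv_infty hφ).differentiable (by simp)) _).hasFDerivAt.comp_hasDerivAt X
    (hasDerivAt_charMap_snd v X)
  exact h.clm_apply (hasDerivAt_const X ((-1, 1) : ℝ × ℝ)) |>.congr_deriv (by simp [charDeriv₂])

theorem continuous_charDeriv (hφ : ContDiff ℝ ∞ φ) : Continuous (charDeriv φ) :=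
  ((contDiff_fderiv_infty hφ).continuous.comp continuous_charMap).clm_apply continuous_const

theorem continuous_charDeriv₂ (hφ : ContDiff ℝ ∞ φ) : Continuous (charDeriv₂ φ) :=
  (((contDiff_fderiv_infty (hφ)).fderiv_right (m := ∞) (by simp)).continuous.comp
    continuous_charMap).clm_apply continuous_const |>.clm_apply continuous_const

theorem charDeriv_eq_zero {z : ℝ × ℝ} (h : charMap z ∉ tsupport φ) : charDeriv φ z = 0 := by
  have : fderiv ℝ φ (charMap z) = 0 :=
    image_eq_zero_of_notMem_tsupport fun h' => h (tsupport_fderiv_subset ℝ h')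
  simp [charDeriv, this]

theorem charDeriv₂_eq_zero {z : ℝ × ℝ} (h : charMap z ∉ tsupport φ) : charDeriv₂ φ z = 0 := by
  have : fderiv ℝ (fderiv ℝ φ) (charMap z) = 0 :=
    image_eq_zero_of_notMem_tsupport fun h' =>
      h (tsupport_fderiv_subset ℝ (tsupport_fderiv_subset ℝ h'))
  simp [charDeriv₂, this]

theorem iteratedDeriv_two_comp (hφ : ContDiff ℝ ∞ φ) {γ : ℝ → ℝ × ℝ} {e : ℝ × ℝ}
    (hγ : ∀ t, HasDerivAt γ e t) (t : ℝ) :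
    iteratedDeriv 2 (fun t => φ (γ t)) t = fderiv ℝ (fderiv ℝ φ) (γ t) e e := by
  have hd := hφ.differentiable (by simp)
  have hd2 := (contDiff_fderiv_infty hφ).differentiable (by simp)
  have h1 : deriv (fun t => φ (γ t)) = fun t => fderiv ℝ φ (γ t) e :=
    funext fun t => ((hd _).hasFDerivAt.comp_hasDerivAt t (hγ t)).deriv
  have h2 : HasDerivAt (fun t => fderiv ℝ φ (γ t)) (fderiv ℝ (fderiv ℝ φ) (γ t) e) t :=
    (hd2 _).hasFDerivAt.comp_hasDerivAt t (hγ t)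
  rw [iteratedDeriv_succ, iteratedDeriv_one, h1,
    (h2.clm_apply (hasDerivAt_const t e)).deriv]
  simp

/-- In characteristic coordinates the wave operator is the mixed derivative `∂_X ∂_v`. -/
theorem wave_operator_eq (hφ : ContDiff ℝ ∞ φ) (z : ℝ × ℝ) :
    iteratedDeriv 2 (fun s => φ ((charMap z).1, s)) (charMap z).2
      - iteratedDeriv 2 (fun x => φ (x, (charMap z).2)) (charMap z).1 = charDeriv₂ φ z := by
  set p := charMap z with hp
  have hs (x s : ℝ) : HasDerivAt (fun s : ℝ => (x, s)) ((0, 1) : ℝ × ℝ) s :=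
    (hasDerivAt_const s x).prodMk (hasDerivAt_id s)
  have hx (x s : ℝ) : HasDerivAt (fun x : ℝ => (x, s)) ((1, 0) : ℝ × ℝ) x :=
    (hasDerivAt_id x).prodMk (hasDerivAt_const x s)
  have e1 := iteratedDeriv_two_comp hφ (hs p.1) p.2
  have e2 := iteratedDeriv_two_comp hφ (fun x => hx x p.2) p.1
  have hsymm : fderiv ℝ (fderiv ℝ φ) p (1, 0) (0, 1) = fderiv ℝ (fderiv ℝ φ) p (0, 1) (1, 0) :=
    (hφ.contDiffAt.isSymmSndFDerivAt (by
      rw [minSmoothness_of_isRCLikeNormedField]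
      exact WithTop.coe_le_coe.2 (le_top : (2 : ℕ∞) ≤ ⊤))).eq _ _
  have d1 : ((1, 1) : ℝ × ℝ) = (1, 0) + (0, 1) := by simp
  have d2 : ((-1, 1) : ℝ × ℝ) = (0, 1) - (1, 0) := by simp
  rw [e1, e2, charDeriv₂, ← hp, d1, d2]
  simp only [map_add, map_sub, add_apply]
  rw [hsymm]
  ring

end Derivatives

/-- Local integrability of `q(X - v)` in the plane, against a continuous factor. -/
theorem integrableOn_comp_sub_mul {q : ℝ → ℝ} (hq : LocallyIntegrable q) {g : ℝ × ℝ → ℝ}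
    (hg : Continuous g) (a b c d : ℝ) :
    IntegrableOn (fun z : ℝ × ℝ => q (z.2 - z.1) * g z) (Icc a b ×ˢ Icc c d) := by
  have hK : IsCompact (Icc a b ×ˢ Icc c d) := isCompact_Icc.prod isCompact_Icc
  have h1 : Integrable (fun z : ℝ × ℝ => (Icc a b).indicator (fun _ => (1 : ℝ)) z.1
      * (Icc (c - b) (d - a)).indicator q z.2) (volume.prod volume) :=
    Integrable.mul_prod ((integrable_indicator_iff measurableSet_Icc).2
      (by simp [IntegrableOn])) ((integrable_indicator_iff measurableSet_Icc).2
      (hq.integrableOn_isCompact isCompact_Icc))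
  have h2 := (measurePreserving_prod_sub (volume : Measure ℝ) (volume : Measure ℝ)).integrable_comp
    h1.aestronglyMeasurable |>.2 h1
  rw [← Measure.volume_eq_prod] at h2
  have h3 : IntegrableOn (fun z : ℝ × ℝ => q (z.2 - z.1)) (Icc a b ×ˢ Icc c d) := by
    refine h2.integrableOn.congr_fun (fun z hz => ?_) hK.measurableSet
    have m1 : z.1 ∈ Icc a b := hz.1
    have m2 : z.2 - z.1 ∈ Icc (c - b) (d - a) :=
      ⟨by linarith [hz.2.1, m1.2], by linarith [hz.2.2, m1.1]⟩
    simp [indicator_of_mem m1, indicator_of_mem m2]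
  exact h3.mul_continuousOn hg.continuousOn hK

theorem integrableOn_comp_sub_mul' {q : ℝ → ℝ} (hq : LocallyIntegrable q) {g : ℝ × ℝ → ℝ}
    (hg : Continuous g) {a b c d : ℝ} (hab : a ≤ b) (hcd : c ≤ d) :
    IntegrableOn (fun z : ℝ × ℝ => q (z.2 - z.1) * g z) (uIoc a b ×ˢ uIoc c d) := by
  refine (integrableOn_comp_sub_mul hq hg a b c d).mono_set (prod_mono ?_ ?_)
  · rw [uIoc_of_le hab]; exact Ioc_subset_Icc_self
  · rw [uIoc_of_le hcd]; exact Ioc_subset_Icc_self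

theorem integral_eq_intervalIntegral_intervalIntegral {f : ℝ × ℝ → ℝ} {a b c d : ℝ} (hab : a ≤ b)
    (hcd : c ≤ d) (hf : IntegrableOn f (uIoc a b ×ˢ uIoc c d))
    (h0 : ∀ z, z ∉ Ioc a b ×ˢ Ioc c d → f z = 0) :
    ∫ z, f z = ∫ v in a..b, ∫ X in c..d, f (v, X) := by
  rw [uIoc_of_le hab, uIoc_of_le hcd] at hf
  rw [← setIntegral_eq_integral_of_forall_compl_eq_zero h0, Measure.volume_eq_prod,
    setIntegral_prod f hf, intervalIntegral.integral_of_le hab]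
  simp only [intervalIntegral.integral_of_le hcd]

theorem intervalIntegrable_integral_snd {f : ℝ × ℝ → ℝ} {a b c d : ℝ} (hcd : c ≤ d)
    (hf : IntegrableOn f (uIoc a b ×ˢ uIoc c d)) :
    IntervalIntegrable (fun v => ∫ X in c..d, f (v, X)) volume a b := by
  rw [intervalIntegrable_iff]
  rw [IntegrableOn, Measure.volume_eq_prod, ← Measure.prod_restrict] at hf
  have := hf.integral_prod_left
  rw [uIoc_of_le hcd] at this
  simpa only [intervalIntegral.integral_of_le hcd, IntegrableOn] using this

/-- A weak solution of the Goursat problem solves the kernel equation: testing with products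
`b(v) a(X)` and integrating once in each characteristic direction gives the equation on the
rectangle `[0, v] × [v, X]`. -/
theorem IsGoursatSolution.exists_isCharacteristicKernel {q : ℝ → ℝ} (hq : LocallyIntegrable q)
    {w : ℝ × ℝ → ℝ} (hw : IsGoursatSolution q w) :
    ∃ B, IsCharacteristicKernel q B ∧ ∀ x s : ℝ, 0 ≤ x → x ≤ s →
      w (x, s) = -(1 / 2) * B ((s - x) / 2, (s + x) / 2) := by
  -- the solution in characteristic coordinates, extended continuously by clamping
  let W : ℝ × ℝ → ℝ := fun z => w (charMap (max z.1 0, max z.2 (max z.1 0)))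
  have hW : Continuous W := by
    refine hw.continuousOn.comp_continuous (continuous_charMap.comp (by fun_prop)) fun z => ?_
    have h1 : 0 ≤ max z.1 0 := le_max_right _ _
    have h2 : max z.1 0 ≤ max z.2 (max z.1 0) := le_max_right _ _
    simp only [charMap, mem_ofPred_eq]
    constructor <;> linarith
  have hWw {v X : ℝ} (hv : 0 ≤ v) (hX : v ≤ X) : W (v, X) = w (charMap (v, X)) := by
    simp only [W, max_eq_left hv, max_eq_left hX]
  have rect {v₀ X₀ : ℝ} (hv : 0 ≤ v₀) (hX : v₀ ≤ X₀) :
      (W (v₀, X₀) - W (0, X₀)) - (W (v₀, v₀) - W (0, v₀))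
        = ∫ X in v₀..X₀, - innerTerm q W v₀ X := by
    -- the weak equation for a product of test functions
    have test (a b : ℝ → ℝ) (ha : ContDiff ℝ ∞ a) (hac : HasCompactSupport a)
        (has : tsupport a ⊆ Ioo v₀ X₀) (hb : ContDiff ℝ ∞ b) (hbc : HasCompactSupport b)
        (hbs : tsupport b ⊆ Ioo 0 v₀) :
        (∫ v in (0 : ℝ)..v₀, (∫ X in v₀..X₀, W (v, X) * deriv a X) * deriv b v)
          + ∫ v in (0 : ℝ)..v₀, (∫ X in v₀..X₀, q (X - v) * (W (v, X) * a X)) * b v = 0 := by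
      have hda := ha.continuous_deriv (n := ∞) (by simp)
      have hdb := hb.continuous_deriv (n := ∞) (by simp)
      have hca := ha.continuous
      have hcb := hb.continuous
      let φ : ℝ × ℝ → ℝ := fun p => b ((p.2 - p.1) / 2) * a ((p.2 + p.1) / 2)
      have hφ : ContDiff ℝ ∞ φ := by
        refine ContDiff.mul (hb.comp ?_) (ha.comp ?_) <;> fun_prop
      have hφc (v X : ℝ) : φ (charMap (v, X)) = b v * a X := by
        simp only [φ, charMap]; congr 2 <;> ring
      have hK : IsCompact (charMap '' (tsupport b ×ˢ tsupport a)) :=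
        (IsCompact.prod hbc hac).image continuous_charMap
      have hsupp : tsupport φ ⊆ charMap '' (tsupport b ×ˢ tsupport a) := by
        refine closure_minimal (fun p hp => ?_) hK.isClosed
        have hp' : b ((p.2 - p.1) / 2) * a ((p.2 + p.1) / 2) ≠ 0 := hp
        exact ⟨((p.2 - p.1) / 2, (p.2 + p.1) / 2),
          ⟨subset_tsupport _ (left_ne_zero_of_mul hp'),
            subset_tsupport _ (right_ne_zero_of_mul hp')⟩,
          charMap_half p.1 p.2⟩
      have hweak := hw.weak φ hφ (hK.of_isClosed_subset (isClosed_tsupport _) hsupp) (by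
        refine hsupp.trans ?_
        rintro _ ⟨z, ⟨hz1, hz2⟩, rfl⟩
        have h1 := hbs hz1
        have h2 := has hz2
        simp only [charMap, mem_ofPred_eq]
        exact ⟨by linarith [h1.2, h2.1], by linarith [h1.1]⟩)
      rw [← integral_comp_charMap_eq_zero_iff] at hweak
      have hcd (v X : ℝ) : charDeriv φ (v, X) = deriv b v * a X := by
        have h1 := hasDerivAt_comp_charMap hφ v X
        simp only [hφc] at h1
        exact h1.unique (((hb.differentiable (by simp)) v).hasDerivAt.mul_const _)
      have hcd2 (v X : ℝ) : charDeriv₂ φ (v, X) = deriv b v * deriv a X := by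
        have h1 := hasDerivAt_charDeriv hφ v X
        simp only [hcd] at h1
        exact h1.unique (((ha.differentiable (by simp)) X).hasDerivAt.const_mul _)
      have b0 {v : ℝ} (h : v ∉ Ioo 0 v₀) : b v = 0 :=
        image_eq_zero_of_notMem_tsupport fun h' => h (hbs h')
      have db0 {v : ℝ} (h : v ∉ Ioo 0 v₀) : deriv b v = 0 :=
        image_eq_zero_of_notMem_tsupport fun h' => h (hbs (tsupport_deriv_subset h'))
      have a0 {X : ℝ} (h : X ∉ Ioo v₀ X₀) : a X = 0 :=
        image_eq_zero_of_notMem_tsupport fun h' => h (has h')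
      have da0 {X : ℝ} (h : X ∉ Ioo v₀ X₀) : deriv a X = 0 :=
        image_eq_zero_of_notMem_tsupport fun h' => h (has (tsupport_deriv_subset h'))
      have hcongr : ∀ z : ℝ × ℝ, w (charMap z) * (iteratedDeriv 2 (fun s => φ ((charMap z).1, s))
            (charMap z).2 - iteratedDeriv 2 (fun x => φ (x, (charMap z).2)) (charMap z).1)
          + q (charMap z).1 * w (charMap z) * φ (charMap z)
          = W z * (deriv b z.1 * deriv a z.2) + q (z.2 - z.1) * (W z * (b z.1 * a z.2)) := by
        rintro ⟨v, X⟩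
        rw [wave_operator_eq hφ, hcd2, hφc]
        by_cases hvm : v ∈ Ioo 0 v₀
        · by_cases hXm : X ∈ Ioo v₀ X₀
          · rw [hWw hvm.1.le (hvm.2.le.trans hXm.1.le)]
            simp only [charMap]
            ring
          · simp [a0 hXm, da0 hXm]
        · simp [b0 hvm, db0 hvm]
      simp only [hcongr] at hweak
      have i1 : IntegrableOn (fun z : ℝ × ℝ => W z * (deriv b z.1 * deriv a z.2))
          (uIoc 0 v₀ ×ˢ uIoc v₀ X₀) := by
        rw [uIoc_of_le hv, uIoc_of_le hX]
        exact (Continuous.continuousOn (by fun_prop)).integrableOn_compact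
          (isCompact_Icc.prod isCompact_Icc) |>.mono_set
          (prod_mono Ioc_subset_Icc_self Ioc_subset_Icc_self)
      have i2 : IntegrableOn (fun z : ℝ × ℝ => q (z.2 - z.1) * (W z * (b z.1 * a z.2)))
          (uIoc 0 v₀ ×ˢ uIoc v₀ X₀) := integrableOn_comp_sub_mul' hq (by fun_prop) hv hX
      have hz (z : ℝ × ℝ) (hz : z ∉ Ioc 0 v₀ ×ˢ Ioc v₀ X₀) :
          z.1 ∉ Ioo 0 v₀ ∨ z.2 ∉ Ioo v₀ X₀ := by
        by_contra! h
        exact hz ⟨Ioo_subset_Ioc_self h.1, Ioo_subset_Ioc_self h.2⟩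
      have z1 (z : ℝ × ℝ) (h : z ∉ Ioc 0 v₀ ×ˢ Ioc v₀ X₀) :
          W z * (deriv b z.1 * deriv a z.2) = 0 := by
        rcases hz z h with h | h
        · simp [db0 h]
        · simp [da0 h]
      have z2 (z : ℝ × ℝ) (h : z ∉ Ioc 0 v₀ ×ˢ Ioc v₀ X₀) :
          q (z.2 - z.1) * (W z * (b z.1 * a z.2)) = 0 := by
        rcases hz z h with h | h
        · simp [b0 h]
        · simp [a0 h]
      rw [integral_add (i1.integrable_of_forall_notMem_eq_zero fun z h => z1 z (by
          rwa [uIoc_of_le hv, uIoc_of_le hX] at h))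
        (i2.integrable_of_forall_notMem_eq_zero fun z h => z2 z (by
          rwa [uIoc_of_le hv, uIoc_of_le hX] at h)),
        integral_eq_intervalIntegral_intervalIntegral hv hX i1 z1,
        integral_eq_intervalIntegral_intervalIntegral hv hX i2 z2] at hweak
      refine Eq.trans ?_ hweak
      congr 1
      · refine intervalIntegral.integral_congr fun v _ => ?_
        simp only [← intervalIntegral.integral_mul_const]
        refine intervalIntegral.integral_congr fun X _ => ?_
        ring
      · refine intervalIntegral.integral_congr fun v _ => ?_
        simp only [← intervalIntegral.integral_mul_const]
        refine intervalIntegral.integral_congr fun X _ => ?_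
        ring
    -- integrate once in `X`
    refine sub_eq_integral_of_weak_deriv (g := fun X => W (v₀, X) - W (0, X)) hX
      (Continuous.continuousOn (by fun_prop)) ?_ fun a ha hac has => ?_
    · exact (((continuous_innerTerm hq hW).comp
        (by fun_prop : Continuous fun u : ℝ => (v₀, u))).neg).intervalIntegrable _ _
    · have hda := ha.continuous_deriv (n := ∞) (by simp)
      have hca := ha.continuous
      have i3 : IntegrableOn (fun z : ℝ × ℝ => q (z.2 - z.1) * (W z * a z.2))
          (uIoc 0 v₀ ×ˢ uIoc v₀ X₀) := integrableOn_comp_sub_mul' hq (by fun_prop) hv hX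
      -- integrate once in `v`, with `a` fixed
      have step := sub_eq_integral_of_weak_deriv (α := 0) (β := v₀)
        (g := fun v => ∫ X in v₀..X₀, W (v, X) * deriv a X)
        (h := fun v => ∫ X in v₀..X₀, q (X - v) * (W (v, X) * a X)) hv
        (Continuous.continuousOn
          (intervalIntegral.continuous_parametric_intervalIntegral_of_continuous'
            (f := fun v X => W (v, X) * deriv a X) (by unfold Function.uncurry; fun_prop) _ _))
        (intervalIntegrable_integral_snd hX i3)
        (fun b hb hbc hbs => test a b ha hac has hb hbc hbs)
      have hWi (v : ℝ) : IntervalIntegrable (fun X => W (v, X) * deriv a X) volume v₀ X₀ :=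
        Continuous.intervalIntegrable (by fun_prop) _ _
      have e1 : ∫ X in v₀..X₀, (W (v₀, X) - W (0, X)) * deriv a X
          = ∫ v in (0 : ℝ)..v₀, ∫ X in v₀..X₀, q (X - v) * (W (v, X) * a X) := by
        rw [← step, ← intervalIntegral.integral_sub (hWi _) (hWi _)]
        simp only [sub_mul]
      rw [e1, intervalIntegral_intervalIntegral_swap (F := fun v X => q (X - v) * (W (v, X) * a X))
        i3, ← intervalIntegral.integral_add (intervalIntegrable_iff.2 ?_) ?_]
      · refine (intervalIntegral.integral_congr (g := fun _ => (0 : ℝ)) fun X _ => ?_).trans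
          (by simp)
        rw [innerTerm_eq]
        have : ∫ v in (0 : ℝ)..v₀, q (X - v) * (W (v, X) * a X)
            = (∫ s in (0 : ℝ)..v₀, W (s, X) * q (X - s)) * a X := by
          rw [← intervalIntegral.integral_mul_const]
          refine intervalIntegral.integral_congr fun v _ => ?_
          ring
        simp only
        rw [this]; ring
      · rw [IntegrableOn, Measure.volume_eq_prod, ← Measure.prod_restrict] at i3
        have := i3.integral_prod_right
        rw [uIoc_of_le hv] at this
        simpa only [intervalIntegral.integral_of_le hv, IntegrableOn] using this
      · exact (((continuous_innerTerm hq hW).comp (by fun_prop : Continuous fun u : ℝ =>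
          (v₀, u))).neg.mul hca).intervalIntegrable _ _
  refine ⟨fun z => -2 * W z, ⟨by fun_prop, fun v X hv hX => ?_⟩, fun x s hx hs => ?_⟩
  · have h0 {X : ℝ} (hX : 0 ≤ X) : W (0, X) = -(1 / 2) * ∫ t in (0 : ℝ)..X, q t := by
      rw [hWw le_rfl hX, ← hw.characteristic X hX]
      simp [charMap]
    have hd : W (v, v) = 0 := by
      rw [hWw hv le_rfl, ← hw.boundary (v + v) (by linarith)]
      simp [charMap]
    have h := rect hv hX
    rw [h0 (hv.trans hX), h0 hv, hd, intervalIntegral.integral_neg] at h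
    have hW2 : Continuous fun z => -2 * W z := by fun_prop
    have hin (u : ℝ) : innerTerm q (fun z => -2 * W z) v u = -2 * innerTerm q W v u := by
      simp only [innerTerm, mul_assoc]
      rw [intervalIntegral.integral_const_mul]
    rw [integral_kernel_eq hq hW2]
    simp only [hin]
    rw [intervalIntegral.integral_const_mul,
      ← intervalIntegral.integral_interval_sub_left (hq.intervalIntegrable_real 0 X)
        (hq.intervalIntegrable_real 0 v)]
    linarith
  · simp only
    rw [hWw (by linarith) (by linarith), charMap_half]
    ring

/-! ### From the kernel equation to the Goursat problem -/

/-- A solution of the kernel equation is, up to the factor `-1/2` and the change of coordinates,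
a weak solution of the Goursat problem: integrate by parts first in `X`, where `∂_X B` is the
integrand of the kernel equation, then in `v`. -/
theorem IsCharacteristicKernel.isGoursatSolution {q : ℝ → ℝ} (hq : LocallyIntegrable q)
    {B : ℝ × ℝ → ℝ} (hB : IsCharacteristicKernel q B) :
    IsGoursatSolution q fun p => -(1 / 2) * B ((p.2 - p.1) / 2, (p.2 + p.1) / 2) := by
  have hBc := hB.continuous
  refine ⟨Continuous.continuousOn (by fun_prop), fun s hs => ?_, fun x hx => ?_,
    fun φ hφ hφc hφs => ?_⟩
  · simp only [sub_zero, add_zero]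
    rw [hB.equation _ _ (by linarith) le_rfl]
    simp
  · have h0 : ((x - x) / 2, (x + x) / 2) = ((0 : ℝ), x) := by ext <;> simp
    simp only [h0]
    rw [hB.equation _ _ le_rfl hx]
    simp [innerTerm]
  rw [← integral_comp_charMap_eq_zero_iff]
  have hcoord (z : ℝ × ℝ) : (((charMap z).2 - (charMap z).1) / 2,
      ((charMap z).2 + (charMap z).1) / 2) = z := by
    simp only [charMap]; ext <;> simp
  simp only [wave_operator_eq hφ, hcoord]
  have hD := continuous_charDeriv hφ
  have hD2 := continuous_charDeriv₂ hφ
  have hφC := hφ.continuous.comp continuous_charMap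
  -- a box `(0, R]²` which contains the support in characteristic coordinates
  obtain ⟨R, hR0, hR⟩ : ∃ R : ℝ, 0 ≤ R ∧ ∀ z : ℝ × ℝ, charMap z ∈ tsupport φ →
      z.1 < R ∧ z.2 < R := by
    obtain ⟨C, hC⟩ := hφc.isBounded.exists_norm_le
    refine ⟨|C| + 1, by positivity, fun z hz => ?_⟩
    have h1 := hC _ hz
    have h2 := hφs hz
    simp only [charMap, mem_ofPred_eq] at h1 h2
    have h3 : |z.2 + z.1| ≤ |C| := ((norm_snd_le (z.2 - z.1, z.2 + z.1)).trans h1).trans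
      (le_abs_self C)
    have h4 := (abs_le.1 h3).2
    constructor <;> linarith
  have hout {v X : ℝ} (h : ¬ (0 < v ∧ v < X ∧ X < R)) : charMap (v, X) ∉ tsupport φ := by
    intro hz
    have h1 := hφs hz
    have h2 := hR _ hz
    simp only [charMap, mem_ofPred_eq] at h1 h2
    exact h ⟨by linarith, by linarith, h2.2⟩
  have φ0 {v X : ℝ} (h : ¬ (0 < v ∧ v < X ∧ X < R)) : φ (charMap (v, X)) = 0 :=
    image_eq_zero_of_notMem_tsupport (hout h)
  have D0 {v X : ℝ} (h : ¬ (0 < v ∧ v < X ∧ X < R)) : charDeriv φ (v, X) = 0 :=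
    charDeriv_eq_zero (hout h)
  have D20 {v X : ℝ} (h : ¬ (0 < v ∧ v < X ∧ X < R)) : charDeriv₂ φ (v, X) = 0 :=
    charDeriv₂_eq_zero (hout h)
  have i1 : IntegrableOn (fun z : ℝ × ℝ => -(1 / 2) * B z * charDeriv₂ φ z)
      (uIoc 0 R ×ˢ uIoc 0 R) := by
    rw [uIoc_of_le hR0]
    exact (Continuous.continuousOn (by fun_prop)).integrableOn_compact
      (isCompact_Icc.prod isCompact_Icc) |>.mono_set
      (prod_mono Ioc_subset_Icc_self Ioc_subset_Icc_self)
  have i2' : IntegrableOn (fun z : ℝ × ℝ => q (z.2 - z.1) * (B z * φ (charMap z)))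
      (uIoc 0 R ×ˢ uIoc 0 R) := integrableOn_comp_sub_mul' hq (hBc.mul hφC) hR0 hR0
  have i2 : IntegrableOn (fun z : ℝ × ℝ => q (charMap z).1 * (-(1 / 2) * B z) * φ (charMap z))
      (uIoc 0 R ×ˢ uIoc 0 R) := by
    refine (i2'.const_mul (-(1 / 2))).congr (Eventually.of_forall fun z => ?_)
    simp only [charMap]; ring
  have hz {z : ℝ × ℝ} (h : z ∉ Ioc 0 R ×ˢ Ioc 0 R) : ¬ (0 < z.1 ∧ z.1 < z.2 ∧ z.2 < R) :=
    fun h' => h ⟨⟨h'.1, (h'.2.1.trans h'.2.2).le⟩, ⟨h'.1.trans h'.2.1, h'.2.2.le⟩⟩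
  have z1 (z : ℝ × ℝ) (h : z ∉ Ioc 0 R ×ˢ Ioc 0 R) : -(1 / 2) * B z * charDeriv₂ φ z = 0 := by
    rw [show charDeriv₂ φ z = 0 from D20 (hz h), mul_zero]
  have z2 (z : ℝ × ℝ) (h : z ∉ Ioc 0 R ×ˢ Ioc 0 R) :
      q (charMap z).1 * (-(1 / 2) * B z) * φ (charMap z) = 0 := by
    rw [show φ (charMap z) = 0 from φ0 (hz h), mul_zero]
  rw [integral_add (i1.integrable_of_forall_notMem_eq_zero fun z h => z1 z (by
      rwa [uIoc_of_le hR0] at h))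
    (i2.integrable_of_forall_notMem_eq_zero fun z h => z2 z (by rwa [uIoc_of_le hR0] at h)),
    integral_eq_intervalIntegral_intervalIntegral hR0 hR0 i1 z1,
    integral_eq_intervalIntegral_intervalIntegral hR0 hR0 i2 z2]
  have hAi (v a b : ℝ) : IntervalIntegrable (fun X => q X - innerTerm q B v X) volume a b :=
    (hq.intervalIntegrable_real _ _).sub (((continuous_innerTerm hq hBc).comp
      (by fun_prop : Continuous fun u : ℝ => (v, u))).intervalIntegrable _ _)
  -- integration by parts in `X`
  have stepX (v : ℝ) (hv0 : 0 ≤ v) (hvR : v ≤ R) :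
      ∫ X in (0 : ℝ)..R, -(1 / 2) * B (v, X) * charDeriv₂ φ (v, X)
        = (1 / 2) * ∫ X in (0 : ℝ)..R, (q X - innerTerm q B v X) * charDeriv φ (v, X) := by
    have hd2i (a b : ℝ) : IntervalIntegrable (fun X => charDeriv₂ φ (v, X)) volume a b :=
      Continuous.intervalIntegrable (by fun_prop) _ _
    have hBv : B (v, v) = 0 := by rw [hB.equation _ _ hv0 le_rfl]; simp
    have e := integral_mul_add_mul_of_primitive hvR (hAi v v R) (hd2i v R)
      (F := fun X => B (v, X)) (G := fun X => charDeriv φ (v, X))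
      (fun X hX => by rw [hBv, zero_add]; exact hB.equation v X hv0 hX.1)
      (fun X _ => by
        rw [intervalIntegral.integral_eq_sub_of_hasDerivAt
          (fun t _ => hasDerivAt_charDeriv hφ v t) (hd2i _ _)]
        ring)
    rw [D0 (v := v) (X := R) (by simp), hBv] at e
    have split {f : ℝ → ℝ} (hf : ∀ a b, IntervalIntegrable f volume a b)
        (h0 : ∀ X ≤ v, f X = 0) : ∫ X in (0 : ℝ)..R, f X = ∫ X in v..R, f X := by
      rw [← intervalIntegral.integral_add_adjacent_intervals (hf 0 v) (hf v R)]
      rw [intervalIntegral.integral_congr (g := fun _ => (0 : ℝ)) fun X hX => ?_]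
      · simp
      · rw [uIcc_of_le hv0] at hX
        exact h0 X hX.2
    rw [split (fun a b => Continuous.intervalIntegrable (by fun_prop) _ _)
      (fun X hX => by rw [D20 (by intro h; linarith [h.2.1]), mul_zero]),
      split (fun a b => (hAi v a b).mul_continuousOn (Continuous.continuousOn (by fun_prop)))
      (fun X hX => by rw [D0 (by intro h; linarith [h.2.1]), mul_zero])]
    simp only [mul_assoc]
    rw [intervalIntegral.integral_const_mul]
    linarith
  -- integration by parts in `v`
  have stepv (X : ℝ) : ∫ v in (0 : ℝ)..R, (q X - innerTerm q B v X) * charDeriv φ (v, X)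
      = ∫ v in (0 : ℝ)..R, q (X - v) * (B (v, X) * φ (charMap (v, X))) := by
    have hdi : IntervalIntegrable (fun v => charDeriv φ (v, X)) volume 0 R :=
      Continuous.intervalIntegrable (by fun_prop) _ _
    have hqi : IntervalIntegrable (fun v => -(B (v, X) * q (X - v))) volume 0 R := by
      refine (IntervalIntegrable.continuousOn_mul ?_ (Continuous.continuousOn (by fun_prop))).neg
      have := (hq.intervalIntegrable_real (X - 0) (X - R)).comp_sub_left X
      simpa using this
    have e := integral_mul_add_mul_of_primitive hR0 hqi hdi
      (F := fun v => q X - innerTerm q B v X) (G := fun v => φ (charMap (v, X)))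
      (fun v _ => by
        rw [innerTerm_eq, innerTerm_eq, intervalIntegral.integral_neg]
        simp [sub_eq_add_neg])
      (fun v _ => by
        rw [intervalIntegral.integral_eq_sub_of_hasDerivAt
          (fun t _ => hasDerivAt_comp_charMap hφ t X)
          (Continuous.intervalIntegrable (by fun_prop) _ _)]
        ring)
    rw [φ0 (v := 0) (X := X) (by simp), φ0 (v := R) (X := X) (by
      intro h; linarith [h.2.1, h.2.2])] at e
    have e2 : ∫ v in (0 : ℝ)..R, q (X - v) * (B (v, X) * φ (charMap (v, X)))
        = - ∫ v in (0 : ℝ)..R, -(B (v, X) * q (X - v)) * φ (charMap (v, X)) := by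
      rw [← intervalIntegral.integral_neg]
      refine intervalIntegral.integral_congr fun v _ => ?_
      ring
    rw [e2]
    linarith
  have i3 : IntegrableOn (Function.uncurry fun v X : ℝ =>
      (q X - innerTerm q B v X) * charDeriv φ (v, X)) (uIoc 0 R ×ˢ uIoc 0 R) := by
    rw [uIoc_of_le hR0]
    have a1 : IntegrableOn (fun z : ℝ × ℝ => q z.2) (Icc 0 R ×ˢ Icc 0 R) := by
      rw [IntegrableOn, Measure.volume_eq_prod, ← Measure.prod_restrict]
      exact (hq.integrableOn_isCompact isCompact_Icc).comp_snd _
    have a2 : IntegrableOn (fun z : ℝ × ℝ => innerTerm q B z.1 z.2) (Icc 0 R ×ˢ Icc 0 R) :=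
      (continuous_innerTerm hq hBc).continuousOn.integrableOn_compact
        (isCompact_Icc.prod isCompact_Icc)
    exact ((a1.sub a2).mul_continuousOn hD.continuousOn
      (isCompact_Icc.prod isCompact_Icc)).mono_set
      (prod_mono Ioc_subset_Icc_self Ioc_subset_Icc_self)
  have e1 : ∫ v in (0 : ℝ)..R, ∫ X in (0 : ℝ)..R, -(1 / 2) * B (v, X) * charDeriv₂ φ (v, X)
      = (1 / 2) * ∫ v in (0 : ℝ)..R, ∫ X in (0 : ℝ)..R,
        q (X - v) * (B (v, X) * φ (charMap (v, X))) := by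
    rw [intervalIntegral_intervalIntegral_swap
        (F := fun v X => q (X - v) * (B (v, X) * φ (charMap (v, X)))) i2',
      ← intervalIntegral.integral_congr fun X _ => stepv X,
      ← intervalIntegral_intervalIntegral_swap i3, ← intervalIntegral.integral_const_mul]
    refine intervalIntegral.integral_congr fun v hv => ?_
    rw [uIcc_of_le hR0] at hv
    exact stepX v hv.1 hv.2
  rw [e1, ← intervalIntegral.integral_const_mul, ← intervalIntegral.integral_add]
  · refine (intervalIntegral.integral_congr (g := fun _ => (0 : ℝ)) fun v _ => ?_).trans (by simp)
    simp only
    rw [← intervalIntegral.integral_const_mul, ← sub_neg_eq_add, sub_eq_zero,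
      ← intervalIntegral.integral_neg]
    refine intervalIntegral.integral_congr fun X _ => ?_
    simp only [charMap]
    ring
  · exact (intervalIntegrable_integral_snd hR0 i2').const_mul _
  · exact intervalIntegrable_integral_snd hR0 i2

/-! ### The Laplace transform of the kernel -/

theorem intervalIntegrable_exp_mul_comp_add {q : ℝ → ℝ} (hq : LocallyIntegrable q) (l p a b : ℝ) :
    IntervalIntegrable (fun t => Real.exp (-l * t) * |q (t + p)|) volume a b := by
  have := (hq.abs_real.intervalIntegrable_real (a + p) (b + p)).comp_add_right p
  simp only [add_sub_cancel_right] at this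
  exact this.continuousOn_mul (Continuous.continuousOn (by fun_prop))

theorem HasWindowBound.intervalIntegral_exp_comp_add_le {q : ℝ → ℝ} {N : ℝ}
    (hq : LocallyIntegrable q) (hN : HasWindowBound q N) {l p y : ℝ} (hl : 0 < l) (hp : 0 ≤ p)
    (hy : 0 ≤ y) : ∫ t in (0 : ℝ)..y, Real.exp (-l * t) * |q (t + p)| ≤ N * (1 + 1 / l) := by
  have e := intervalIntegral.integral_comp_add_right (a := 0) (b := y)
    (fun t => Real.exp (-l * (t - p)) * |q t|) p
  simp only [add_sub_cancel_right] at e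
  rw [e, zero_add]
  exact hN.integral_exp_le hq hl hp (by linarith)

theorem HasWindowBound.integrableOn_exp_comp_add {q : ℝ → ℝ} {N : ℝ}
    (hq : LocallyIntegrable q) (hN : HasWindowBound q N) {l p : ℝ} (hl : 0 < l) (hp : 0 ≤ p) :
    IntegrableOn (fun t => Real.exp (-l * t) * |q (t + p)|) (Ioi 0) := by
  refine integrableOn_Ioi_of_intervalIntegral_norm_bounded (N * (1 + 1 / l)) 0 (b := id)
    (l := atTop) (fun y => ?_) tendsto_id ?_
  · have := intervalIntegrable_exp_mul_comp_add hq l p 0 y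
    exact this.1
  · filter_upwards [eventually_ge_atTop (0 : ℝ)] with y hy
    refine le_trans (le_of_eq ?_) (hN.intervalIntegral_exp_comp_add_le hq hl hp hy)
    refine intervalIntegral.integral_congr fun t _ => ?_
    simp

theorem HasWindowBound.integral_exp_comp_add_le {q : ℝ → ℝ} {N : ℝ}
    (hq : LocallyIntegrable q) (hN : HasWindowBound q N) {l p : ℝ} (hl : 0 < l) (hp : 0 ≤ p) :
    ∫ t in Ioi (0 : ℝ), Real.exp (-l * t) * |q (t + p)| ≤ N * (1 + 1 / l) := by
  refine le_of_tendsto (intervalIntegral_tendsto_integral_Ioi 0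
    (hN.integrableOn_exp_comp_add hq hl hp) tendsto_id) ?_
  filter_upwards [eventually_ge_atTop (0 : ℝ)] with y hy
  exact hN.intervalIntegral_exp_comp_add_le hq hl hp hy

/-- Fubini's theorem in convolution form, from the measure preserving shear `(v, s) ↦ (s, v - s)`.
It turns the Laplace transform of the inner term into an iterated integral. -/
theorem integral_integral_comp_sub {H : ℝ × ℝ → ℂ} (hH : Integrable H) :
    Integrable (fun v => ∫ s, H (s, v - s)) ∧ ∫ v, ∫ s, H (s, v - s) = ∫ t, ∫ s, H (s, t) := by
  rw [Measure.volume_eq_prod] at hH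
  have hmp := measurePreserving_prod_sub_swap (volume : Measure ℝ) (volume : Measure ℝ)
  have h2 : Integrable (fun z : ℝ × ℝ => H (z.2, z.1 - z.2)) (volume.prod volume) :=
    (hmp.integrable_comp hH.aestronglyMeasurable).2 hH
  refine ⟨h2.integral_prod_left, ?_⟩
  calc ∫ v, ∫ s, H (s, v - s) = ∫ z : ℝ × ℝ, H (z.2, z.1 - z.2) ∂(volume.prod volume) :=
        (integral_prod _ h2).symm
    _ = ∫ z, H z ∂(volume.prod volume) := by
        have hm := hmp.map_eq
        have h3 := integral_map (μ := (volume : Measure ℝ).prod (volume : Measure ℝ))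
          hmp.measurable.aemeasurable (f := H) (by rw [hm]; exact hH.aestronglyMeasurable)
        rw [hm] at h3
        exact h3.symm
    _ = _ := integral_prod_symm _ hH

theorem norm_exp_neg_two_mul (k : ℂ) (t : ℝ) :
    ‖Complex.exp (-2 * k * t)‖ = Real.exp (-(2 * k.re) * t) := by
  rw [Complex.norm_exp]
  simp

/-- A solution of the kernel equation with the exponential bound `|B(v, X)| ≤ M e^{κ(v + X)}`. -/
structure IsBoundedKernel (q : ℝ → ℝ) (B : ℝ × ℝ → ℝ) (κ M : ℝ) : Prop
    extends IsCharacteristicKernel q B where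
  nonneg : 0 ≤ M
  bound : ∀ v X : ℝ, 0 ≤ v → v ≤ X → |B (v, X)| ≤ M * Real.exp (κ * (v + X))

/-- The Laplace transform `F(x) = ∫_0^∞ e^{-2kv} B(v, v + x) dv` of a kernel along the lines of
constant `x`. The Weyl solution is `e^{-kx} (1 - F(x))`. -/
noncomputable def laplaceKernel (k : ℂ) (B : ℝ × ℝ → ℝ) (x : ℝ) : ℂ :=
  ∫ v in Ioi (0 : ℝ), Complex.exp (-2 * k * v) * (B (v, v + x) : ℂ)

/-- The derivative `G(p)` of `laplaceKernel`; at `p = 0` it is the Laplace transform of the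
`A`-amplitude. -/
noncomputable def laplaceDensity (q : ℝ → ℝ) (k : ℂ) (B : ℝ × ℝ → ℝ) (p : ℝ) : ℂ :=
  ∫ v in Ioi (0 : ℝ), Complex.exp (-2 * k * v) * ((q (v + p) - innerTerm q B v (v + p) : ℝ) : ℂ)

section Laplace

variable {q : ℝ → ℝ} {N : ℝ} {B : ℝ × ℝ → ℝ} {κ M : ℝ} {k : ℂ}

theorem IsBoundedKernel.norm_laplaceKernel_le (hB : IsBoundedKernel q B κ M) (hk : κ < k.re)
    {x : ℝ} (hx : 0 ≤ x) :
    ‖laplaceKernel k B x‖ ≤ M / (2 * (k.re - κ)) * Real.exp (κ * x) := by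
  have hpos : 0 < 2 * (k.re - κ) := by linarith
  have hi : IntegrableOn (fun v => M * Real.exp (κ * x) * Real.exp (-(2 * (k.re - κ)) * v))
      (Ioi 0) := (exp_neg_integrableOn_Ioi 0 hpos).const_mul _
  refine (norm_integral_le_of_norm_le hi ?_).trans_eq ?_
  · refine (ae_restrict_iff' measurableSet_Ioi).2 (Eventually.of_forall fun v hv => ?_)
    have hv : 0 < v := hv
    rw [norm_mul, norm_exp_neg_two_mul, Complex.norm_real, Real.norm_eq_abs]
    calc _ ≤ Real.exp (-(2 * k.re) * v) * (M * Real.exp (κ * (v + (v + x)))) := by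
          gcongr
          exact hB.bound _ _ hv.le (by linarith)
      _ = _ := by
          rw [mul_left_comm, ← Real.exp_add, mul_assoc, ← Real.exp_add]
          ring_nf
  · rw [integral_const_mul, integral_exp_mul_Ioi (by linarith)]
    simp only [mul_zero, Real.exp_zero]
    field_simp

theorem locallyIntegrable_comp_add {q : ℝ → ℝ} (hq : LocallyIntegrable q) (p : ℝ) :
    LocallyIntegrable fun t => q (t + p) := by
  have h : LocallyIntegrable q (Measure.map (fun t : ℝ => t + p) volume) := by
    rwa [(measurePreserving_add_right volume p).map_eq]
  exact (locallyIntegrable_map_homeomorph (Homeomorph.addRight p)).1 h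

/-- Joint integrability of the function whose shear is the integrand of the transformed inner
term; this is where `κ < Re k` enters. -/
theorem IsBoundedKernel.integrable_convolution (hq : LocallyIntegrable q)
    (hN : HasWindowBound q N) (hB : IsBoundedKernel q B κ M) (hκ : 0 < κ) (hk : κ < k.re)
    {p : ℝ} (hp : 0 ≤ p) :
    Integrable (fun z : ℝ × ℝ => (Ioi (0 : ℝ) ×ˢ Ioi (0 : ℝ)).indicator (fun z : ℝ × ℝ =>
      Complex.exp (-2 * k * (z.1 + z.2 : ℝ)) * ((B (z.1, z.1 + (z.2 + p)) * q (z.2 + p) : ℝ) : ℂ))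
      z) := by
  have hpos : 0 < 2 * (k.re - κ) := by linarith
  rw [integrable_indicator_iff (measurableSet_Ioi.prod measurableSet_Ioi)]
  have hi : IntegrableOn (fun z : ℝ × ℝ => (M * Real.exp (κ * p)
      * Real.exp (-(2 * (k.re - κ)) * z.1)) * (Real.exp (-(2 * k.re - κ) * z.2) * |q (z.2 + p)|))
      (Ioi (0 : ℝ) ×ˢ Ioi (0 : ℝ)) := by
    rw [IntegrableOn, Measure.volume_eq_prod, ← Measure.prod_restrict]
    exact Integrable.mul_prod ((exp_neg_integrableOn_Ioi 0 hpos).const_mul _)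
      (hN.integrableOn_exp_comp_add hq (by linarith) hp)
  refine hi.mono' ?_ ?_
  · have hBc := hB.continuous
    have hm : AEStronglyMeasurable (fun z : ℝ × ℝ => q (z.2 + p)) volume := by
      rw [Measure.volume_eq_prod]
      exact (locallyIntegrable_comp_add hq p).aestronglyMeasurable.comp_snd
    have h2 : AEStronglyMeasurable (fun z : ℝ × ℝ => B (z.1, z.1 + (z.2 + p))) volume :=
      Continuous.aestronglyMeasurable (by fun_prop)
    exact ((Continuous.aestronglyMeasurable (by fun_prop)).mul
      (Complex.continuous_ofReal.comp_aestronglyMeasurable (h2.mul hm))).restrict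
  · refine (ae_restrict_iff' (measurableSet_Ioi.prod measurableSet_Ioi)).2
      (Eventually.of_forall fun z hz => ?_)
    have h1 : 0 < z.1 := hz.1
    have h2 : 0 < z.2 := hz.2
    rw [norm_mul, norm_exp_neg_two_mul, Complex.norm_real, Real.norm_eq_abs, abs_mul]
    calc _ ≤ Real.exp (-(2 * k.re) * (z.1 + z.2)) * ((M * Real.exp (κ * (z.1 + (z.1 + (z.2 + p)))))
          * |q (z.2 + p)|) := by
          gcongr
          exact hB.bound _ _ h1.le (by linarith)
      _ = M * (Real.exp (-(2 * k.re) * (z.1 + z.2)) * Real.exp (κ * (z.1 + (z.1 + (z.2 + p)))))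
          * |q (z.2 + p)| := by ring
      _ = M * (Real.exp (κ * p) * Real.exp (-(2 * (k.re - κ)) * z.1)
          * Real.exp (-(2 * k.re - κ) * z.2)) * |q (z.2 + p)| := by
          rw [← Real.exp_add, ← Real.exp_add, ← Real.exp_add]; ring_nf
      _ = _ := by ring

theorem integral_convolution_eq (k : ℂ) {p : ℝ} {v : ℝ} (hv : 0 < v) :
    ∫ s, (Ioi (0 : ℝ) ×ˢ Ioi (0 : ℝ)).indicator (fun z : ℝ × ℝ =>
      Complex.exp (-2 * k * (z.1 + z.2 : ℝ)) * ((B (z.1, z.1 + (z.2 + p)) * q (z.2 + p) : ℝ) : ℂ))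
      (s, v - s) = Complex.exp (-2 * k * v) * (innerTerm q B v (v + p) : ℂ) := by
  have e : ∀ s, (Ioi (0 : ℝ) ×ˢ Ioi (0 : ℝ)).indicator (fun z : ℝ × ℝ =>
      Complex.exp (-2 * k * (z.1 + z.2 : ℝ)) * ((B (z.1, z.1 + (z.2 + p)) * q (z.2 + p) : ℝ) : ℂ))
      (s, v - s) = (Ioo 0 v).indicator (fun s =>
        Complex.exp (-2 * k * v) * ((B (s, v + p) * q (v + p - s) : ℝ) : ℂ)) s := by
    intro s
    by_cases hs : s ∈ Ioo 0 v
    · rw [indicator_of_mem hs, indicator_of_mem]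
      · simp only
        have e1 : s + (v - s) = v := by ring
        have e2 : s + (v - s + p) = v + p := by ring
        have e3 : v - s + p = v + p - s := by ring
        rw [e1, e2, e3]
      · exact ⟨hs.1, by simpa using hs.2⟩
    · rw [indicator_of_notMem hs, indicator_of_notMem]
      rintro ⟨h1, h2⟩
      exact hs ⟨h1, by simpa using h2⟩
  simp only [e]
  rw [integral_indicator measurableSet_Ioo, integral_const_mul, innerTerm_eq,
    intervalIntegral.integral_of_le hv.le, integral_Ioc_eq_integral_Ioo]
  congr 1
  exact integral_ofReal

theorem integral_convolution_fst_eq (k : ℂ) {p : ℝ} {t : ℝ} (ht : 0 < t) :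
    ∫ s, (Ioi (0 : ℝ) ×ˢ Ioi (0 : ℝ)).indicator (fun z : ℝ × ℝ =>
      Complex.exp (-2 * k * (z.1 + z.2 : ℝ)) * ((B (z.1, z.1 + (z.2 + p)) * q (z.2 + p) : ℝ) : ℂ))
      (s, t) = Complex.exp (-2 * k * t) * q (t + p) * laplaceKernel k B (t + p) := by
  have e : ∀ s, (Ioi (0 : ℝ) ×ˢ Ioi (0 : ℝ)).indicator (fun z : ℝ × ℝ =>
      Complex.exp (-2 * k * (z.1 + z.2 : ℝ)) * ((B (z.1, z.1 + (z.2 + p)) * q (z.2 + p) : ℝ) : ℂ))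
      (s, t) = (Ioi 0).indicator (fun s : ℝ => Complex.exp (-2 * k * t) * q (t + p) *
        (Complex.exp (-2 * k * s) * (B (s, s + (t + p)) : ℂ))) s := by
    intro s
    by_cases hs : s ∈ Ioi 0
    · rw [indicator_of_mem hs, indicator_of_mem (show (s, t) ∈ Ioi (0 : ℝ) ×ˢ Ioi (0 : ℝ) from
        ⟨hs, ht⟩)]
      simp only
      push_cast
      rw [mul_add, Complex.exp_add]
      ring
    · rw [indicator_of_notMem hs, indicator_of_notMem]
      rintro ⟨h1, h2⟩
      exact hs h1
  simp only [e]
  rw [integral_indicator measurableSet_Ioi, integral_const_mul]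
  rfl

theorem HasWindowBound.integrableOn_cexp_mul (hq : LocallyIntegrable q)
    (hN : HasWindowBound q N) (hk : 0 < k.re) {p : ℝ} (hp : 0 ≤ p) :
    IntegrableOn (fun v : ℝ => Complex.exp (-2 * k * v) * (q (v + p) : ℂ)) (Ioi 0) := by
  refine (hN.integrableOn_exp_comp_add hq (l := 2 * k.re) (by linarith) hp).mono' ?_ ?_
  · exact ((Continuous.aestronglyMeasurable (by fun_prop)).mul
      (Complex.continuous_ofReal.comp_aestronglyMeasurable
        (locallyIntegrable_comp_add hq p).aestronglyMeasurable)).restrict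
  · refine Eventually.of_forall fun v => ?_
    rw [norm_mul, norm_exp_neg_two_mul, Complex.norm_real, Real.norm_eq_abs]

/-- The Laplace transform in `v` of the inner term is `∫_0^∞ e^{-2kt} q(t + p) F(t + p) dt`. -/
theorem IsBoundedKernel.convolution_laplace (hq : LocallyIntegrable q)
    (hN : HasWindowBound q N) (hB : IsBoundedKernel q B κ M) (hκ : 0 < κ) (hk : κ < k.re)
    {p : ℝ} (hp : 0 ≤ p) :
    IntegrableOn (fun v : ℝ => Complex.exp (-2 * k * v) * (innerTerm q B v (v + p) : ℂ)) (Ioi 0) ∧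
    IntegrableOn (fun t : ℝ => Complex.exp (-2 * k * t) * q (t + p) * laplaceKernel k B (t + p))
      (Ioi 0) ∧
    ∫ v in Ioi (0 : ℝ), Complex.exp (-2 * k * v) * (innerTerm q B v (v + p) : ℂ)
      = ∫ t in Ioi (0 : ℝ), Complex.exp (-2 * k * t) * q (t + p) * laplaceKernel k B (t + p) := by
  have hH := hB.integrable_convolution hq hN hκ hk hp
  obtain ⟨h1, h2⟩ := integral_integral_comp_sub hH
  have h3 := hH
  rw [Measure.volume_eq_prod] at h3
  have h3 := h3.integral_prod_right
  have e1 : ∀ v, ∫ s, (Ioi (0 : ℝ) ×ˢ Ioi (0 : ℝ)).indicator (fun z : ℝ × ℝ =>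
      Complex.exp (-2 * k * (z.1 + z.2 : ℝ)) * ((B (z.1, z.1 + (z.2 + p)) * q (z.2 + p) : ℝ) : ℂ))
      (s, v - s) = (Ioi 0).indicator (fun v : ℝ =>
        Complex.exp (-2 * k * v) * (innerTerm q B v (v + p) : ℂ)) v := by
    intro v
    by_cases hv : v ∈ Ioi 0
    · rw [indicator_of_mem hv, integral_convolution_eq k hv]
    · rw [indicator_of_notMem hv, integral_eq_zero_of_ae (Eventually.of_forall fun s => ?_)]
      refine indicator_of_notMem (fun h => hv ?_) _
      have a : 0 < s := h.1
      have b : 0 < v - s := h.2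
      exact mem_Ioi.2 (by linarith)
  have e2 : ∀ t, ∫ s, (Ioi (0 : ℝ) ×ˢ Ioi (0 : ℝ)).indicator (fun z : ℝ × ℝ =>
      Complex.exp (-2 * k * (z.1 + z.2 : ℝ)) * ((B (z.1, z.1 + (z.2 + p)) * q (z.2 + p) : ℝ) : ℂ))
      (s, t) = (Ioi 0).indicator (fun t : ℝ =>
        Complex.exp (-2 * k * t) * q (t + p) * laplaceKernel k B (t + p)) t := by
    intro t
    by_cases ht : t ∈ Ioi 0
    · rw [indicator_of_mem ht, integral_convolution_fst_eq k ht]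
    · rw [indicator_of_notMem ht, integral_eq_zero_of_ae (Eventually.of_forall fun s => ?_)]
      exact indicator_of_notMem (fun h => ht h.2) _
  simp only [e1, e2] at h1 h2 h3
  rw [integral_indicator measurableSet_Ioi, integral_indicator measurableSet_Ioi] at h2
  exact ⟨(integrable_indicator_iff measurableSet_Ioi).1 h1,
    (integrable_indicator_iff measurableSet_Ioi).1 h3, h2⟩

theorem IsBoundedKernel.integrableOn_laplaceDensity (hq : LocallyIntegrable q)
    (hN : HasWindowBound q N) (hB : IsBoundedKernel q B κ M) (hκ : 0 < κ) (hk : κ < k.re)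
    {p : ℝ} (hp : 0 ≤ p) :
    IntegrableOn (fun v : ℝ => Complex.exp (-2 * k * v)
      * ((q (v + p) - innerTerm q B v (v + p) : ℝ) : ℂ)) (Ioi 0) := by
  refine ((hN.integrableOn_cexp_mul hq (hκ.trans hk) hp).sub
    (hB.convolution_laplace hq hN hκ hk hp).1).congr (Eventually.of_forall fun v => ?_)
  simp only [Pi.sub_apply]
  push_cast; ring

/-- The density satisfies `G(p) = ∫_0^∞ e^{-2kt} q(t + p) (1 - F(t + p)) dt`. -/
theorem IsBoundedKernel.laplaceDensity_eq (hq : LocallyIntegrable q)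
    (hN : HasWindowBound q N) (hB : IsBoundedKernel q B κ M) (hκ : 0 < κ) (hk : κ < k.re)
    {p : ℝ} (hp : 0 ≤ p) :
    IntegrableOn (fun t : ℝ => Complex.exp (-2 * k * t) * q (t + p)
        * (1 - laplaceKernel k B (t + p))) (Ioi 0) ∧
    laplaceDensity q k B p = ∫ t in Ioi (0 : ℝ), Complex.exp (-2 * k * t) * q (t + p)
        * (1 - laplaceKernel k B (t + p)) := by
  obtain ⟨h1, h2, h3⟩ := hB.convolution_laplace hq hN hκ hk hp
  have h0 := hN.integrableOn_cexp_mul hq (hκ.trans hk) hp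
  constructor
  · refine (h0.sub h2).congr (Eventually.of_forall fun v => ?_)
    simp only [Pi.sub_apply]; ring
  · simp only [laplaceDensity, Complex.ofReal_sub, mul_sub, mul_one]
    rw [integral_sub h0 h1, integral_sub h0 h2, h3]

theorem IsBoundedKernel.norm_laplaceDensity_le (hq : LocallyIntegrable q)
    (hN : HasWindowBound q N) (hB : IsBoundedKernel q B κ M) (hκ : 0 < κ) (hk : κ < k.re)
    {p : ℝ} (hp : 0 ≤ p) :
    ‖laplaceDensity q k B p‖
      ≤ (1 + M / (2 * (k.re - κ))) * (N * (1 + 1 / κ)) * Real.exp (κ * p) := by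
  have hM := hB.nonneg
  have hpos : 0 < 2 * (k.re - κ) := by linarith
  set C := M / (2 * (k.re - κ)) with hC
  have hC0 : 0 ≤ C := by positivity
  rw [(hB.laplaceDensity_eq hq hN hκ hk hp).2]
  refine (norm_integral_le_of_norm_le ((hN.integrableOn_exp_comp_add hq hκ hp).const_mul
    ((1 + C) * Real.exp (κ * p))) ?_).trans ?_
  · refine (ae_restrict_iff' measurableSet_Ioi).2 (Eventually.of_forall fun t ht => ?_)
    have ht : 0 < t := ht
    rw [norm_mul, norm_mul, norm_exp_neg_two_mul, Complex.norm_real, Real.norm_eq_abs]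
    have h1 : ‖1 - laplaceKernel k B (t + p)‖ ≤ (1 + C) * Real.exp (κ * (t + p)) := by
      refine (norm_sub_le _ _).trans ?_
      rw [norm_one, add_mul, one_mul]
      exact add_le_add (Real.one_le_exp (by positivity))
        (hB.norm_laplaceKernel_le hk (by linarith))
    have h2 : Real.exp (-(2 * k.re) * t) * Real.exp (κ * (t + p))
        ≤ Real.exp (κ * p) * Real.exp (-κ * t) := by
      rw [← Real.exp_add, ← Real.exp_add]
      exact Real.exp_le_exp.2 (by nlinarith)
    calc _ ≤ Real.exp (-(2 * k.re) * t) * |q (t + p)| * ((1 + C) * Real.exp (κ * (t + p))) := by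
          gcongr
      _ = (1 + C) * (Real.exp (-(2 * k.re) * t) * Real.exp (κ * (t + p))) * |q (t + p)| := by ring
      _ ≤ (1 + C) * (Real.exp (κ * p) * Real.exp (-κ * t)) * |q (t + p)| := by gcongr
      _ = _ := by ring
  · rw [integral_const_mul]
    calc _ ≤ (1 + C) * Real.exp (κ * p) * (N * (1 + 1 / κ)) := by
          gcongr
          exact hN.integral_exp_comp_add_le hq hκ hp
      _ = _ := by ring

/-- `F` is the primitive of `G` that vanishes at `0`. -/
theorem IsBoundedKernel.laplaceKernel_eq (hq : LocallyIntegrable q)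
    (hN : HasWindowBound q N) (hB : IsBoundedKernel q B κ M) (hκ : 0 < κ) (hk : κ < k.re)
    {x : ℝ} (hx : 0 ≤ x) :
    laplaceKernel k B x = ∫ p in (0 : ℝ)..x, laplaceDensity q k B p := by
  have hM := hB.nonneg
  have hN0 := hN.nonneg
  have hBc := hB.continuous
  have hpos : 0 < 2 * (k.re - κ) := by linarith
  have hint : Integrable (Function.uncurry fun p v : ℝ => Complex.exp (-2 * k * v)
      * ((q (v + p) - innerTerm q B v (v + p) : ℝ) : ℂ))
      ((volume.restrict (uIoc 0 x)).prod (volume.restrict (Ioi 0))) := by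
    rw [uIoc_of_le hx]
    have i1 : Integrable (fun z : ℝ × ℝ => Complex.exp (-2 * k * z.2) * (q (z.2 + z.1) : ℂ))
        ((volume.restrict (Ioc 0 x)).prod (volume.restrict (Ioi 0))) := by
      have h1 : Integrable (fun z : ℝ × ℝ =>
          (Ioc 0 x).indicator (fun p : ℝ => Complex.exp (2 * k * p)) z.1
          * (Ioi 0).indicator (fun t : ℝ => Complex.exp (-2 * k * t) * (q t : ℂ)) z.2)
          (volume.prod volume) := by
        refine Integrable.mul_prod ((integrable_indicator_iff measurableSet_Ioc).2 ?_)
          ((integrable_indicator_iff measurableSet_Ioi).2 ?_)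
        · exact ((Continuous.continuousOn (by fun_prop)).integrableOn_compact
            isCompact_Icc).mono_set Ioc_subset_Icc_self
        · simpa using hN.integrableOn_cexp_mul hq (hκ.trans hk) (p := 0) le_rfl
      have h2 := (measurePreserving_prod_add (volume : Measure ℝ)
        (volume : Measure ℝ)).integrable_comp h1.aestronglyMeasurable |>.2 h1
      rw [Measure.prod_restrict]
      refine h2.integrableOn.congr_fun (fun z hz => ?_) (measurableSet_Ioc.prod measurableSet_Ioi)
      have m1 : z.1 ∈ Ioc 0 x := hz.1
      have m0 : 0 < z.2 := hz.2
      have m2 : z.1 + z.2 ∈ Ioi 0 := mem_Ioi.2 (by linarith [m1.1])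
      simp only [Function.comp, indicator_of_mem m1, indicator_of_mem m2]
      rw [← mul_assoc, ← Complex.exp_add, add_comm z.1]
      congr 2
      push_cast; ring
    have i2 : Integrable (fun z : ℝ × ℝ => Complex.exp (-2 * k * z.2)
        * (innerTerm q B z.2 (z.2 + z.1) : ℂ))
        ((volume.restrict (Ioc 0 x)).prod (volume.restrict (Ioi 0))) := by
      have hi : Integrable (fun z : ℝ × ℝ => (M * (N * (1 + 1 / κ)) * Real.exp (κ * z.1))
          * Real.exp (-(2 * (k.re - κ)) * z.2))
          ((volume.restrict (Ioc 0 x)).prod (volume.restrict (Ioi 0))) := by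
        refine Integrable.mul_prod (f := fun p => M * (N * (1 + 1 / κ)) * Real.exp (κ * p)) ?_
          (exp_neg_integrableOn_Ioi 0 hpos)
        exact ((Continuous.continuousOn (by fun_prop)).integrableOn_compact isCompact_Icc).mono_set
            Ioc_subset_Icc_self
      have hc : Continuous fun z : ℝ × ℝ => innerTerm q B z.2 (z.2 + z.1) :=
        (continuous_innerTerm hq hBc).comp
          (by fun_prop : Continuous fun z : ℝ × ℝ => (z.2, z.2 + z.1))
      refine hi.mono' (Continuous.aestronglyMeasurable (by fun_prop)) ?_
      rw [Measure.prod_restrict]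
      refine (ae_restrict_iff' (measurableSet_Ioc.prod measurableSet_Ioi)).2
        (Eventually.of_forall fun z hz => ?_)
      have m1 : 0 < z.1 := hz.1.1
      have m2 : 0 < z.2 := hz.2
      rw [norm_mul, norm_exp_neg_two_mul, Complex.norm_real, Real.norm_eq_abs]
      calc _ ≤ Real.exp (-(2 * k.re) * z.2) * (M * (N * (1 + 1 / κ))
            * Real.exp (κ * (z.2 + (z.2 + z.1)))) := by
            gcongr
            exact hN.abs_innerTerm_le hq hκ hBc hM m2.le (by linarith) fun v' h0 h1 =>
              hB.bound v' _ h0 h1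
        _ = _ := by
            rw [mul_left_comm, ← Real.exp_add, mul_assoc (M * _), ← Real.exp_add]
            ring_nf
    refine (i1.sub i2).congr (Eventually.of_forall fun z => ?_)
    simp only [Pi.sub_apply, Function.uncurry]
    push_cast; ring
  simp only [laplaceDensity]
  rw [intervalIntegral_integral_swap hint, laplaceKernel]
  refine setIntegral_congr_fun measurableSet_Ioi fun v hv => ?_
  have hv : 0 < v := hv
  rw [intervalIntegral.integral_const_mul, intervalIntegral.integral_ofReal,
    hB.equation v (v + x) hv.le (by linarith)]
  congr 2
  have := intervalIntegral.integral_comp_add_left (a := 0) (b := x)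
    (fun u => q u - innerTerm q B v u) v
  rw [this, add_zero]

end Laplace

/-! ### The exponentially decaying solution -/

section Jost

variable {q : ℝ → ℝ} {N : ℝ} {B : ℝ × ℝ → ℝ} {κ M : ℝ} {k : ℂ}

/-- In terms of the kernel, `e^{-2kp} G(p) = G(0) - ∫_0^p e^{-2kt} q (1 - F) dt`. -/
theorem IsBoundedKernel.exp_mul_laplaceDensity (hq : LocallyIntegrable q)
    (hN : HasWindowBound q N) (hB : IsBoundedKernel q B κ M) (hκ : 0 < κ) (hk : κ < k.re)
    {p : ℝ} (hp : 0 ≤ p) :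
    Complex.exp (-2 * k * p) * laplaceDensity q k B p = laplaceDensity q k B 0
      - ∫ t in (0 : ℝ)..p, Complex.exp (-2 * k * t) * q t * (1 - laplaceKernel k B t) := by
  obtain ⟨i0, e0⟩ := hB.laplaceDensity_eq hq hN hκ hk le_rfl
  obtain ⟨ip, ep⟩ := hB.laplaceDensity_eq hq hN hκ hk hp
  simp only [add_zero] at i0 e0
  have h1 : ∫ t in Ioi p, Complex.exp (-2 * k * t) * q t * (1 - laplaceKernel k B t)
      = Complex.exp (-2 * k * p) * laplaceDensity q k B p := by
    have hmp := (measurePreserving_add_right volume p).setIntegral_preimage_emb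
      (measurableEmbedding_addRight p)
      (fun t : ℝ => Complex.exp (-2 * k * t) * q t * (1 - laplaceKernel k B t)) (Ioi p)
    rw [← hmp, ep, ← integral_const_mul]
    have : (fun t : ℝ => t + p) ⁻¹' Ioi p = Ioi 0 := by ext; simp
    rw [this]
    refine setIntegral_congr_fun measurableSet_Ioi fun t _ => ?_
    simp only [Complex.ofReal_add, mul_add, Complex.exp_add]
    ring
  rw [← h1, e0, ← intervalIntegral.integral_interval_add_Ioi i0
    (i0.mono_set (Ioi_subset_Ioi hp))]
  ring

/-- The function `e^{-kx} (1 - F(x))` is an exponentially decaying solution, with initial data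
`u(0) = 1` and `u'(0) = -k - G(0)`. -/
theorem IsBoundedKernel.exists_decaying_solution (hq : LocallyIntegrable q)
    (hN : HasWindowBound q N) (hB : IsBoundedKernel q B κ M) (hκ : 0 < κ) (hk : κ < k.re) :
    ∃ u u' : ℝ → ℂ, (∀ x, HasDerivAt u (u' x) x) ∧ Continuous u' ∧
      (∀ x, 0 ≤ x → u' x = u' 0 + ∫ t in (0 : ℝ)..x, ((q t : ℂ) - (-k ^ 2)) * u t) ∧
      u 0 = 1 ∧ u' 0 = -k - laplaceDensity q k B 0 ∧
      ∃ C ε : ℝ, 0 < ε ∧ ∀ x, 0 ≤ x →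
        ‖u x‖ ≤ C * Real.exp (-ε * x) ∧ ‖u' x‖ ≤ C * Real.exp (-ε * x) := by
  have hM := hB.nonneg
  have hpos : 0 < 2 * (k.re - κ) := by linarith
  obtain ⟨i0, -⟩ := hB.laplaceDensity_eq hq hN hκ hk le_rfl
  simp only [add_zero] at i0
  -- `θ` is extended by zero to negative arguments, so that all functions live on the line
  let θ : ℝ → ℂ := (Ioi 0).indicator fun t : ℝ =>
    Complex.exp (-2 * k * t) * q t * (1 - laplaceKernel k B t)
  have hθ : Integrable θ := (integrable_indicator_iff measurableSet_Ioi).2 i0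
  let P : ℝ → ℂ := fun p => laplaceDensity q k B 0 - ∫ t in (0 : ℝ)..p, θ t
  have hP : Continuous P := continuous_const.sub (hθ.continuous_primitive 0)
  have hPG {p : ℝ} (hp : 0 ≤ p) : P p = Complex.exp (-2 * k * p) * laplaceDensity q k B p := by
    rw [hB.exp_mul_laplaceDensity hq hN hκ hk hp]
    simp only [P]
    congr 1
    rw [intervalIntegral.integral_of_le hp, intervalIntegral.integral_of_le hp]
    exact setIntegral_congr_fun measurableSet_Ioc fun t ht =>
      indicator_of_mem (mem_Ioi.2 ht.1) _
  let F : ℝ → ℂ := fun x => ∫ p in (0 : ℝ)..x, Complex.exp (2 * k * p) * P p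
  have hFd (x : ℝ) : HasDerivAt F (Complex.exp (2 * k * x) * P x) x := by
    have hc : Continuous fun p : ℝ => Complex.exp (2 * k * p) * P p := by fun_prop
    exact intervalIntegral.integral_hasDerivAt_right (hc.intervalIntegrable _ _)
      hc.stronglyMeasurable.stronglyMeasurableAtFilter hc.continuousAt
  have hFc : Continuous F := continuous_iff_continuousAt.2 fun x => (hFd x).continuousAt
  have hGP {p : ℝ} (hp : 0 ≤ p) : Complex.exp (2 * k * p) * P p = laplaceDensity q k B p := by
    rw [hPG hp, ← mul_assoc, ← Complex.exp_add]
    simp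
  have hFF {x : ℝ} (hx : 0 ≤ x) : F x = laplaceKernel k B x := by
    rw [hB.laplaceKernel_eq hq hN hκ hk hx]
    refine intervalIntegral.integral_congr fun p hp => ?_
    rw [uIcc_of_le hx] at hp
    exact hGP hp.1
  let u : ℝ → ℂ := fun x => Complex.exp (-k * x) * (1 - F x)
  let u' : ℝ → ℂ := fun x => -k * u x - Complex.exp (k * x) * P x
  have hexp (c : ℂ) (x : ℝ) : HasDerivAt (fun x : ℝ => Complex.exp (c * x))
      (c * Complex.exp (c * x)) x := by
    have := ((hasDerivAt_id x).ofReal_comp.const_mul c).cexp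
    simpa [mul_comm] using this
  have huc : Continuous u := by simp only [u]; fun_prop
  have hu'c : Continuous u' := by simp only [u']; fun_prop
  have hud (x : ℝ) : HasDerivAt u (u' x) x := by
    refine ((hexp (-k) x).mul ((hFd x).const_sub 1)).congr_deriv ?_
    simp only [u', u]
    have : Complex.exp (-k * x) * (Complex.exp (2 * k * x) * P x) = Complex.exp (k * x) * P x := by
      rw [← mul_assoc, ← Complex.exp_add]; ring_nf
    linear_combination -this
  have hF0 : F 0 = 0 := by simp [F]
  have hu0 : u 0 = 1 := by simp [u, hF0]
  refine ⟨u, u', hud, hu'c, fun x hx => ?_, hu0, ?_, ?_⟩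
  · have hE : ∀ y ∈ Icc 0 x, Complex.exp (k * y) = Complex.exp (k * (0 : ℝ))
        + ∫ t in (0 : ℝ)..y, k * Complex.exp (k * t) := fun y _ => by
      rw [intervalIntegral.integral_eq_sub_of_hasDerivAt (fun t _ => hexp k t)
        (Continuous.intervalIntegrable (by fun_prop) _ _)]
      ring
    have hPp : ∀ y ∈ Icc 0 x, P y = P 0 + ∫ t in (0 : ℝ)..y, -θ t := fun y _ => by
      simp [P, sub_eq_add_neg]
    have e1 := integral_mul_add_mul_of_primitive hx
      (Continuous.intervalIntegrable (by fun_prop) _ _) hθ.neg.intervalIntegrable hE hPp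
    have e2 : u x - u 0 = ∫ t in (0 : ℝ)..x, u' t :=
      (intervalIntegral.integral_eq_sub_of_hasDerivAt (fun t _ => hud t)
        (hu'c.intervalIntegrable _ _)).symm
    have e3 : ∫ t in (0 : ℝ)..x, u' t = -k * (∫ t in (0 : ℝ)..x, u t)
        - ∫ t in (0 : ℝ)..x, Complex.exp (k * t) * P t := by
      rw [← intervalIntegral.integral_const_mul, ← intervalIntegral.integral_sub
        (Continuous.intervalIntegrable (by fun_prop) _ _)
        (Continuous.intervalIntegrable (by fun_prop) _ _)]
    have e4 : ∫ t in (0 : ℝ)..x, k * Complex.exp (k * t) * P t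
        = k * ∫ t in (0 : ℝ)..x, Complex.exp (k * t) * P t := by
      rw [← intervalIntegral.integral_const_mul]
      simp only [mul_assoc]
    have iθ : IntervalIntegrable (fun t : ℝ => Complex.exp (k * t) * -θ t) volume 0 x :=
      hθ.neg.intervalIntegrable.continuousOn_mul (Continuous.continuousOn (by fun_prop))
    have e5 : ∫ t in (0 : ℝ)..x, ((q t : ℂ) - (-k ^ 2)) * u t
        = k ^ 2 * (∫ t in (0 : ℝ)..x, u t) - ∫ t in (0 : ℝ)..x, Complex.exp (k * t) * -θ t := by
      rw [← intervalIntegral.integral_const_mul, ← intervalIntegral.integral_sub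
        (Continuous.intervalIntegrable (by fun_prop) _ _) iθ, intervalIntegral.integral_of_le hx,
        intervalIntegral.integral_of_le hx]
      refine setIntegral_congr_fun measurableSet_Ioc fun t ht => ?_
      have : θ t = Complex.exp (-2 * k * t) * q t * (1 - F t) := by
        rw [hFF ht.1.le]
        exact indicator_of_mem (mem_Ioi.2 ht.1) _
      simp only [this, u]
      have h2 : Complex.exp (k * t) * Complex.exp (-2 * k * t) = Complex.exp (-k * t) := by
        rw [← Complex.exp_add]; ring_nf
      rw [← h2]
      ring
    simp only [u'] at e3 ⊢
    rw [e5]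
    simp only [Complex.ofReal_zero, mul_zero, Complex.exp_zero, one_mul] at e1 ⊢
    rw [e4] at e1
    rw [e3] at e2
    linear_combination -k * e2 + e1
  · simp only [u', hu0, P]
    simp
  · refine ⟨(‖k‖ * (1 + M / (2 * (k.re - κ)))) + (1 + M / (2 * (k.re - κ)))
      + (1 + M / (2 * (k.re - κ))) * (N * (1 + 1 / κ)), k.re - κ, by linarith, fun x hx => ?_⟩
    have hN0 := hN.nonneg
    set C := M / (2 * (k.re - κ)) with hC
    have hC0 : 0 ≤ C := by positivity
    have hee : Real.exp (-k.re * x) * Real.exp (κ * x) = Real.exp (-(k.re - κ) * x) := by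
      rw [← Real.exp_add]; ring_nf
    have hne : ‖Complex.exp (-k * x)‖ = Real.exp (-k.re * x) := by
      rw [Complex.norm_exp]; simp
    have b1 : ‖u x‖ ≤ (1 + C) * Real.exp (-(k.re - κ) * x) := by
      simp only [u]
      rw [norm_mul, hne, hFF hx]
      calc _ ≤ Real.exp (-k.re * x) * ((1 + C) * Real.exp (κ * x)) := by
            gcongr
            refine (norm_sub_le _ _).trans ?_
            rw [norm_one, add_mul, one_mul]
            exact add_le_add (Real.one_le_exp (by positivity)) (hB.norm_laplaceKernel_le hk hx)
        _ = _ := by rw [mul_left_comm, hee]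
    have b2 : ‖Complex.exp (k * x) * P x‖
        ≤ (1 + C) * (N * (1 + 1 / κ)) * Real.exp (-(k.re - κ) * x) := by
      rw [hPG hx, ← mul_assoc, ← Complex.exp_add, show k * x + -2 * k * x = -k * x by ring,
        norm_mul, hne]
      calc _ ≤ Real.exp (-k.re * x) * ((1 + C) * (N * (1 + 1 / κ)) * Real.exp (κ * x)) := by
            gcongr
            exact hB.norm_laplaceDensity_le hq hN hκ hk hx
        _ = _ := by rw [mul_left_comm, hee]
    have hpe := Real.exp_pos (-(k.re - κ) * x)
    have t1 : 0 ≤ (1 + C) * (N * (1 + 1 / κ)) * Real.exp (-(k.re - κ) * x) := by positivity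
    have t2 : 0 ≤ ‖k‖ * (1 + C) * Real.exp (-(k.re - κ) * x) := by positivity
    have t3 : 0 ≤ (1 + C) * Real.exp (-(k.re - κ) * x) := by positivity
    constructor
    · linarith
    · have b3 : ‖u' x‖ ≤ ‖k‖ * ‖u x‖ + ‖Complex.exp (k * x) * P x‖ := by
        refine (norm_sub_le _ _).trans_eq ?_
        rw [norm_mul, norm_neg]
      have b4 : ‖k‖ * ‖u x‖ ≤ ‖k‖ * ((1 + C) * Real.exp (-(k.re - κ) * x)) := by gcongr
      linarith

end Jost

/-! ### Uniqueness of square integrable solutions -/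

/-- Uniqueness for the initial value problem `d'' = g d`, `d(0) = d'(0) = 0` with locally
integrable `g`: just above the infimum of the points with `d ≠ 0` the integral operator is a
contraction. -/
theorem eq_zero_of_integral_eq {g d d' : ℝ → ℂ} (hg : ∀ a b, IntervalIntegrable g volume a b)
    (hd : ContinuousOn d (Ici 0)) (h1 : ∀ x, 0 ≤ x → d x = ∫ t in (0 : ℝ)..x, d' t)
    (h2 : ∀ x, 0 ≤ x → d' x = ∫ t in (0 : ℝ)..x, g t * d t) {x : ℝ} (hx : 0 ≤ x) : d x = 0 := by
  by_contra hne
  let S : Set ℝ := {t | 0 ≤ t ∧ d t ≠ 0}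
  have hSne : S.Nonempty := ⟨x, hx, hne⟩
  have hSb : BddBelow S := ⟨0, fun t ht => ht.1⟩
  set a := sInf S with ha
  have ha0 : 0 ≤ a := le_csInf hSne fun t ht => ht.1
  have hlt {t : ℝ} (h0 : 0 ≤ t) (hta : t < a) : d t = 0 := by
    by_contra hn
    exact notMem_of_lt_csInf hta hSb ⟨h0, hn⟩
  obtain ⟨b, hb1, hab, hb2⟩ :
      ∃ b, (∫ t in a..b, ‖g t‖) < 1 / (2 * (a + 1)) ∧ a < b ∧ b ≤ a + 1 := by
    have hc := intervalIntegral.continuous_primitive (fun a b => (hg a b).norm) a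
    have h0 : ∀ᶠ y in 𝓝[>] a, (∫ t in a..y, ‖g t‖) < 1 / (2 * (a + 1)) := by
      refine nhdsWithin_le_nhds (hc.continuousAt.eventually_lt continuousAt_const ?_)
      rw [intervalIntegral.integral_same]
      positivity
    obtain ⟨b, hb, hb'⟩ := (h0.and (Ioc_mem_nhdsGT (show a < a + 1 by linarith))).exists
    exact ⟨b, hb, hb'.1, hb'.2⟩
  have hb0 : 0 ≤ b := ha0.trans hab.le
  have hdb : ContinuousOn d (Icc 0 b) := hd.mono Icc_subset_Ici_self
  obtain ⟨y, hy, hmax⟩ := isCompact_Icc.exists_isMaxOn (nonempty_Icc.2 hb0) hdb.norm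
  have hm {t : ℝ} (ht : t ∈ Icc 0 b) : ‖d t‖ ≤ ‖d y‖ := hmax ht
  have hgd {s t : ℝ} (hs : s ∈ Icc 0 b) (ht : t ∈ Icc 0 b) :
      IntervalIntegrable (fun t => ‖g t * d t‖) volume s t :=
    ((hg s t).mul_continuousOn (hdb.mono (uIcc_subset_Icc hs ht))).norm
  have m0 : (0 : ℝ) ∈ Icc 0 b := ⟨le_rfl, hb0⟩
  have ma : a ∈ Icc 0 b := ⟨ha0, hab.le⟩
  have mb : b ∈ Icc 0 b := ⟨hb0, le_rfl⟩
  have hd' {t : ℝ} (ht : t ∈ Icc 0 b) : ‖d' t‖ ≤ ‖d y‖ * (1 / (2 * (a + 1))) := by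
    calc ‖d' t‖ ≤ ∫ s in (0 : ℝ)..t, ‖g s * d s‖ := by
          rw [h2 t ht.1]
          exact intervalIntegral.norm_integral_le_integral_norm ht.1
      _ ≤ ∫ s in (0 : ℝ)..b, ‖g s * d s‖ :=
          intervalIntegral.integral_mono_interval le_rfl ht.1 ht.2
            (Eventually.of_forall fun _ => norm_nonneg _) (hgd m0 mb)
      _ = (∫ s in (0 : ℝ)..a, ‖g s * d s‖) + ∫ s in a..b, ‖g s * d s‖ :=
          (intervalIntegral.integral_add_adjacent_intervals (hgd m0 ma) (hgd ma mb)).symm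
      _ = ∫ s in a..b, ‖g s * d s‖ := by
          rw [intervalIntegral.integral_of_le ha0, integral_Ioc_eq_integral_Ioo,
            setIntegral_eq_zero_of_forall_eq_zero, zero_add]
          intro s hs
          rw [hlt hs.1.le hs.2, mul_zero, norm_zero]
      _ ≤ ∫ s in a..b, ‖d y‖ * ‖g s‖ := by
          refine intervalIntegral.integral_mono_on hab.le (hgd ma mb)
            ((hg a b).norm.const_mul _) fun s hs => ?_
          rw [norm_mul, mul_comm]
          gcongr
          exact hm ⟨ha0.trans hs.1, hs.2⟩
      _ = ‖d y‖ * ∫ s in a..b, ‖g s‖ := intervalIntegral.integral_const_mul _ _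
      _ ≤ _ := by gcongr
  have hdy : ‖d y‖ ≤ ‖d y‖ * (1 / (2 * (a + 1))) * |y - 0| := by
    nth_rewrite 1 [h1 y hy.1]
    refine intervalIntegral.norm_integral_le_of_norm_le_const fun t ht => hd' ?_
    rw [uIoc_of_le hy.1] at ht
    exact ⟨ht.1.le, ht.2.trans hy.2⟩
  have hz : ‖d y‖ = 0 := by
    have h3 : |y - 0| ≤ a + 1 := by rw [sub_zero, abs_of_nonneg hy.1]; exact hy.2.trans hb2
    have h4 : ‖d y‖ * (1 / (2 * (a + 1))) * |y - 0| ≤ ‖d y‖ * (1 / (2 * (a + 1))) * (a + 1) := by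
      gcongr
    have h5 : ‖d y‖ * (1 / (2 * (a + 1))) * (a + 1) = ‖d y‖ / 2 := by field_simp
    linarith [norm_nonneg (d y)]
  have : b ≤ a := by
    refine le_csInf hSne fun t ht => ?_
    by_contra hlt'
    have := hm ⟨ht.1, (not_le.1 hlt').le⟩
    rw [hz] at this
    exact ht.2 (norm_le_zero_iff.1 this)
  linarith

theorem integrableOn_mul_of_sq {u v : ℝ → ℂ} {s : Set ℝ} (hs : MeasurableSet s)
    (hu : ContinuousOn u s) (hv : ContinuousOn v s)
    (hu2 : IntegrableOn (fun x => ‖u x‖ ^ 2) s) (hv2 : IntegrableOn (fun x => ‖v x‖ ^ 2) s) :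
    IntegrableOn (fun x => u x * v x) s := by
  refine (hu2.add hv2).mono' ((hu.mul hv).aestronglyMeasurable hs)
    (Eventually.of_forall fun x => ?_)
  rw [norm_mul]
  simp only [Pi.add_apply]
  nlinarith [sq_nonneg (‖u x‖ - ‖v x‖), sq_nonneg (‖u x‖), sq_nonneg ‖v x‖]

theorem integrableOn_sq_of_norm_le_exp {u : ℝ → ℂ} (hu : Continuous u) {C ε : ℝ} (hε : 0 < ε)
    (h : ∀ x, 0 ≤ x → ‖u x‖ ≤ C * Real.exp (-ε * x)) :
    IntegrableOn (fun x => ‖u x‖ ^ 2) (Ioi 0) := by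
  refine ((exp_neg_integrableOn_Ioi 0 (b := 2 * ε) (by linarith)).const_mul (C ^ 2)).mono'
    (Continuous.aestronglyMeasurable (by fun_prop)) ?_
  refine (ae_restrict_iff' measurableSet_Ioi).2 (Eventually.of_forall fun x hx => ?_)
  have hx : 0 < x := hx
  rw [norm_pow, norm_norm]
  calc ‖u x‖ ^ 2 ≤ (C * Real.exp (-ε * x)) ^ 2 := by gcongr; exact h x hx.le
    _ = C ^ 2 * Real.exp (-(2 * ε) * x) := by
        rw [mul_pow, ← Real.exp_nat_mul]; push_cast; ring_nf

/-- In the presence of a solution `u` with `u, u' ∈ L²` and `u(0) = 1`, every square integrable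
solution is a multiple of `u`: since `(u v)' = W + 2 u' v` with the constant Wronskian `W`, and
`u v`, `u' v` are integrable, `W` vanishes. -/
theorem eq_mul_of_squareIntegrable {q : ℝ → ℝ} (hq : LocallyIntegrable q) {z : ℂ} {u u' v : ℝ → ℂ}
    (hu : ∀ x, HasDerivAt u (u' x) x) (hu'c : Continuous u')
    (hu' : ∀ x, 0 ≤ x → u' x = u' 0 + ∫ t in (0 : ℝ)..x, ((q t : ℂ) - z) * u t) (hu0 : u 0 = 1)
    (hu2 : IntegrableOn (fun x => ‖u x‖ ^ 2) (Ioi 0))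
    (hu'2 : IntegrableOn (fun x => ‖u' x‖ ^ 2) (Ioi 0)) (hv : IsSchrodingerSolution q z v)
    (hv2 : IntegrableOn (fun x => ‖v x‖ ^ 2) (Ioi 0)) {x : ℝ} (hx : 0 ≤ x) :
    v x = v 0 * u x := by
  have huc : Continuous u := continuous_iff_continuousAt.2 fun x => (hu x).continuousAt
  have hvc : ContinuousOn v (Ici 0) := hv.1.continuousOn
  have hgi (a b : ℝ) : IntervalIntegrable (fun t => (q t : ℂ) - z) volume a b :=
    IntervalIntegrable.sub ⟨Integrable.ofReal (hq.intervalIntegrable_real a b).1,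
      Integrable.ofReal (hq.intervalIntegrable_real a b).2⟩ intervalIntegrable_const
  have hIcc {x : ℝ} (hx : 0 ≤ x) : uIcc 0 x ⊆ Ici 0 := by
    rw [uIcc_of_le hx]; exact Icc_subset_Ici_self
  have hgu (a b : ℝ) : IntervalIntegrable (fun t => ((q t : ℂ) - z) * u t) volume a b :=
    (hgi a b).mul_continuousOn huc.continuousOn
  have hgv {x : ℝ} (hx : 0 ≤ x) :
      IntervalIntegrable (fun t => ((q t : ℂ) - z) * v t) volume 0 x :=
    (hgi 0 x).mul_continuousOn (hvc.mono (hIcc hx))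
  let v' : ℝ → ℂ := derivWithin v (Ici 0)
  have hv' : ∀ x, 0 ≤ x → v' x = v' 0 + ∫ t in (0 : ℝ)..x, ((q t : ℂ) - z) * v t := hv.2
  have hv'c {x : ℝ} (hx : 0 ≤ x) : ContinuousOn v' (uIcc 0 x) := by
    refine ((continuousOn_const (c := v' 0)).add
      (intervalIntegral.continuousOn_primitive_interval' (hgv hx) left_mem_uIcc)).congr
      fun t ht => ?_
    exact hv' t (hIcc hx ht)
  have hvi {x : ℝ} (hx : 0 ≤ x) : v x = v 0 + ∫ t in (0 : ℝ)..x, v' t := by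
    rw [intervalIntegral.integral_eq_sub_of_hasDeriv_right (hvc.mono (hIcc hx))
      (fun t ht => ?_) (hv'c hx).intervalIntegrable]
    · ring
    · rw [min_eq_left hx] at ht
      exact ((hv.1 t ht.1.le).hasDerivWithinAt).mono (Ioi_subset_Ici ht.1.le)
  have hui (x : ℝ) : u x = u 0 + ∫ t in (0 : ℝ)..x, u' t := by
    rw [intervalIntegral.integral_eq_sub_of_hasDerivAt (fun t _ => hu t)
      (hu'c.intervalIntegrable _ _)]
    ring
  -- the Wronskian is constant
  have hW {x : ℝ} (hx : 0 ≤ x) : u x * v' x - v x * u' x = u 0 * v' 0 - v 0 * u' 0 := by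
    have e1 := integral_mul_add_mul_of_primitive hx (hu'c.intervalIntegrable 0 x) (hgv hx)
      (fun y _ => hui y) (fun y hy => hv' y hy.1)
    have e2 := integral_mul_add_mul_of_primitive hx (hv'c hx).intervalIntegrable (hgu 0 x)
      (fun y hy => hvi hy.1) (fun y hy => hu' y hy.1)
    have e3 : ∫ t in (0 : ℝ)..x, u t * (((q t : ℂ) - z) * v t)
        = ∫ t in (0 : ℝ)..x, v t * (((q t : ℂ) - z) * u t) :=
      intervalIntegral.integral_congr fun t _ => by ring
    have e4 : ∫ t in (0 : ℝ)..x, u' t * v' t = ∫ t in (0 : ℝ)..x, v' t * u' t :=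
      intervalIntegral.integral_congr fun t _ => by ring
    rw [e3, e4] at e1
    linear_combination e2 - e1
  set W := u 0 * v' 0 - v 0 * u' 0 with hWdef
  have hvIoi : ContinuousOn v (Ioi 0) := hvc.mono Ioi_subset_Ici_self
  have i1 : IntegrableOn (fun x => u x * v x) (Ioi 0) :=
    integrableOn_mul_of_sq measurableSet_Ioi huc.continuousOn hvIoi hu2 hv2
  have i2 : IntegrableOn (fun x => u' x * v x) (Ioi 0) :=
    integrableOn_mul_of_sq measurableSet_Ioi hu'c.continuousOn hvIoi hu'2 hv2
  have hprod {x : ℝ} (hx : 0 ≤ x) :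
      u x * v x = u 0 * v 0 + (W * x + 2 * ∫ t in (0 : ℝ)..x, u' t * v t) := by
    have e1 := integral_mul_add_mul_of_primitive hx (hu'c.intervalIntegrable 0 x)
      (hv'c hx).intervalIntegrable (fun y _ => hui y) (fun y hy => hvi hy.1)
    have i3 : IntervalIntegrable (fun t => u' t * v t) volume 0 x :=
      (hu'c.continuousOn.mul (hvc.mono (hIcc hx))).intervalIntegrable
    have e2 : ∫ t in (0 : ℝ)..x, u t * v' t = W * x + ∫ t in (0 : ℝ)..x, u' t * v t := by
      have : W * x = ∫ t in (0 : ℝ)..x, W := by simp [mul_comm]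
      rw [this, ← intervalIntegral.integral_add intervalIntegrable_const i3]
      refine intervalIntegral.integral_congr fun t ht => ?_
      have := hW (hIcc hx ht)
      linear_combination this
    rw [e2] at e1
    linear_combination -e1
  have hW0 : W = 0 := by
    by_contra hWne
    have hWpos : 0 < ‖W‖ := norm_pos_iff.2 hWne
    set D := ‖u 0 * v 0‖ + 2 * ∫ t in Ioi (0 : ℝ), ‖u' t * v t‖ with hD
    have hD0 : 0 ≤ D := by
      have : 0 ≤ ∫ t in Ioi (0 : ℝ), ‖u' t * v t‖ := integral_nonneg fun _ => norm_nonneg _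
      positivity
    have hlow {x : ℝ} (hx : (D + 1) / ‖W‖ ≤ x) : 1 ≤ ‖u x * v x‖ := by
      have hx0 : 0 ≤ x := le_trans (by positivity) hx
      have h1 : ‖∫ t in (0 : ℝ)..x, u' t * v t‖ ≤ ∫ t in Ioi (0 : ℝ), ‖u' t * v t‖ := by
        refine (intervalIntegral.norm_integral_le_integral_norm hx0).trans ?_
        rw [intervalIntegral.integral_of_le hx0]
        exact setIntegral_mono_set i2.norm (Eventually.of_forall fun _ => norm_nonneg _)
          Ioc_subset_Ioi_self.eventuallyLE
      have h2 : ‖W * x‖ ≤ ‖u x * v x‖ + (‖u 0 * v 0‖ + 2 * ‖∫ t in (0 : ℝ)..x, u' t * v t‖) := by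
        have : W * x = u x * v x - (u 0 * v 0 + 2 * ∫ t in (0 : ℝ)..x, u' t * v t) := by
          rw [hprod hx0]; ring
        rw [this]
        refine (norm_sub_le _ _).trans ?_
        gcongr
        refine (norm_add_le _ _).trans_eq ?_
        rw [norm_mul (2 : ℂ)]
        simp
      rw [norm_mul, Complex.norm_real, Real.norm_of_nonneg hx0] at h2
      have h3 : D + 1 ≤ ‖W‖ * x := by
        rw [div_le_iff₀ hWpos] at hx
        linarith
      linarith
    have hx0 : 0 ≤ (D + 1) / ‖W‖ := by positivity
    have i4 : IntegrableOn (fun _ => (1 : ℝ)) (Ioi ((D + 1) / ‖W‖)) := by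
      refine (i1.mono_set (Ioi_subset_Ioi hx0)).norm.mono' aestronglyMeasurable_const ?_
      refine (ae_restrict_iff' measurableSet_Ioi).2 (Eventually.of_forall fun x hx => ?_)
      rw [norm_one]
      exact hlow (le_of_lt hx)
    rw [integrableOn_const_iff] at i4
    simp at i4
  have hd0 := eq_zero_of_integral_eq (g := fun t => (q t : ℂ) - z) (d := fun x => v x - v 0 * u x)
    (d' := fun x => v' x - v 0 * u' x) hgi
    (hvc.sub (continuousOn_const.mul huc.continuousOn)) (fun x hx => ?_) (fun x hx => ?_) hx
  · exact sub_eq_zero.1 hd0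
  · rw [intervalIntegral.integral_sub (hv'c hx).intervalIntegrable
      (Continuous.intervalIntegrable (by fun_prop) _ _), intervalIntegral.integral_const_mul]
    rw [hvi hx, hui x, hu0]
    ring
  · simp only [mul_sub]
    rw [intervalIntegral.integral_sub (hgv hx)]
    · simp only [mul_left_comm _ (v 0)]
      rw [intervalIntegral.integral_const_mul, hv' x hx, hu' x hx]
      rw [hWdef, hu0] at hW0
      linear_combination hW0
    · simp only [mul_left_comm _ (v 0)]
      exact (hgu 0 x).const_mul _

/-! ### Dependence on the potential on the half-line -/

section Congruence

variable {q₁ q₂ : ℝ → ℝ}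

theorem IsSchrodingerSolution.congr (h : ∀ x, 0 ≤ x → q₁ x = q₂ x) {z : ℂ} {u : ℝ → ℂ}
    (hu : IsSchrodingerSolution q₁ z u) : IsSchrodingerSolution q₂ z u := by
  refine ⟨hu.1, fun x hx => ?_⟩
  rw [hu.2 x hx]
  congr 1
  refine intervalIntegral.integral_congr fun t ht => ?_
  rw [uIcc_of_le hx] at ht
  simp only [h t ht.1]

theorem IsWeylSolution.congr (h : ∀ x, 0 ≤ x → q₁ x = q₂ x) {z : ℂ} {u : ℝ → ℂ}
    (hu : IsWeylSolution q₁ z u) : IsWeylSolution q₂ z u :=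
  ⟨hu.solution.congr h, hu.nontrivial, hu.squareIntegrable⟩

theorem titchmarshWeylM_congr (h : ∀ x, 0 ≤ x → q₁ x = q₂ x) (z : ℂ) :
    titchmarshWeylM q₁ z = titchmarshWeylM q₂ z := by
  have : IsWeylSolution q₁ z = IsWeylSolution q₂ z := by
    ext u
    exact ⟨fun hu => hu.congr h, fun hu => hu.congr fun x hx => (h x hx).symm⟩
  unfold titchmarshWeylM
  generalize IsWeylSolution q₁ z = P at this ⊢
  subst this
  rfl

theorem IsGoursatSolution.congr (h : ∀ x, 0 ≤ x → q₁ x = q₂ x) {w : ℝ × ℝ → ℝ}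
    (hw : IsGoursatSolution q₁ w) : IsGoursatSolution q₂ w := by
  refine ⟨hw.continuousOn, hw.boundary, fun x hx => ?_, fun φ h1 h2 h3 => ?_⟩
  · rw [hw.characteristic x hx]
    congr 1
    refine intervalIntegral.integral_congr fun t ht => ?_
    rw [uIcc_of_le hx] at ht
    exact h t ht.1
  · rw [← hw.weak φ h1 h2 h3]
    congr 1
    ext p
    by_cases hp : p ∈ tsupport φ
    · rw [h p.1 (h3 hp).1.le]
    · rw [image_eq_zero_of_notMem_tsupport hp]
      simp

theorem IsResponseFunction.congr (h : ∀ x, 0 ≤ x → q₁ x = q₂ x) {r : ℝ → ℝ}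
    (hr : IsResponseFunction q₁ r) : IsResponseFunction q₂ r := by
  obtain ⟨w, hw, hd⟩ := hr
  exact ⟨w, hw.congr h, hd⟩

theorem IsVolterraKernel.congr (h : ∀ x, 0 ≤ x → q₁ x = q₂ x) {K : ℝ → ℝ → ℝ}
    (hK : IsVolterraKernel q₁ K) : IsVolterraKernel q₂ K := by
  refine ⟨hK.continuousOn.congr fun p hp => ?_, fun x y hy hx => ?_⟩
  · simp only [h p.1 (hp.1.trans hp.2)]
  · rw [hK.equation x y hy hx, h x (hy.trans hx)]
    congr 1
    refine intervalIntegral.integral_congr fun v hv => ?_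
    rw [uIcc_of_le hy] at hv
    simp only [h (x - v) (by linarith [hv.2])]

end Congruence

theorem IsUniformlyLocallyIntegrable.locallyIntegrable_indicator {q : ℝ → ℝ}
    (hq : IsUniformlyLocallyIntegrable q) : LocallyIntegrable ((Ici 0).indicator q) := by
  rw [locallyIntegrable_iff]
  intro K hK
  have h : IntegrableOn q (K ∩ Ici 0) :=
    hq.locallyIntegrable.integrableOn_compact_subset inter_subset_right
      (hK.inter_right isClosed_Ici)
  rw [IntegrableOn, integrable_indicator_iff measurableSet_Ici, IntegrableOn,
    Measure.restrict_restrict measurableSet_Ici, inter_comm]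
  exact h

theorem IsUniformlyLocallyIntegrable.hasWindowBound {q : ℝ → ℝ}
    (hq : IsUniformlyLocallyIntegrable q) :
    HasWindowBound ((Ici 0).indicator q) (windowNorm q) := by
  intro p hp
  have e : ∫ t in p..(p + 1), |(Ici 0).indicator q t| = ∫ t in p..(p + 1), |q t| := by
    refine intervalIntegral.integral_congr fun t ht => ?_
    rw [uIcc_of_le (by linarith)] at ht
    simp only [indicator_of_mem (mem_Ici.2 (hp.trans ht.1))]
  rw [e]
  exact le_ciSup hq.bddAbove (⟨p, hp⟩ : ℝ≥0)

/-! ### The response function and the Titchmarsh-Weyl function -/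

section LocallyIntegrablePotential

variable {q : ℝ → ℝ} {N : ℝ}

/-- Every response function is given, almost everywhere, by the diagonal of the kernel. -/
theorem IsResponseFunction.ae_eq (hq : LocallyIntegrable q) (hN : HasWindowBound q N) {r : ℝ → ℝ}
    (hr : IsResponseFunction q r) {B : ℝ × ℝ → ℝ} (hB : IsCharacteristicKernel q B) :
    ∀ᵐ s ∂(volume.restrict (Ioi (0 : ℝ))),
      r s = -(1 / 2) * (q (s / 2) - innerTerm q B (s / 2) (s / 2)) := by
  obtain ⟨w, hw, hd⟩ := hr
  obtain ⟨B', hB', hwB'⟩ := hw.exists_isCharacteristicKernel hq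
  have hwB : ∀ x s : ℝ, 0 ≤ x → x ≤ s → w (x, s) = -(1 / 2) * B ((s - x) / 2, (s + x) / 2) := by
    intro x s hx hs
    rw [hwB' x s hx hs, hB'.eq hq hN hB (by linarith) (by linarith)]
  filter_upwards [hd, hB.ae_hasDerivWithinAt hq hwB] with s h1 h2
  exact (uniqueDiffWithinAt_Ici (0 : ℝ)).eq_deriv _ h1 h2

/-- The `A`-amplitude is the diagonal of the kernel, `A(α) = q(α) - ∫_0^α B(v, α) q(α - v) dv`. -/
theorem IsResponseFunction.ae_aAmplitude_eq (hq : LocallyIntegrable q) (hN : HasWindowBound q N)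
    {r : ℝ → ℝ} (hr : IsResponseFunction q r) {B : ℝ × ℝ → ℝ} (hB : IsCharacteristicKernel q B) :
    ∀ᵐ α ∂(volume.restrict (Ioi (0 : ℝ))), aAmplitude r α = q α - innerTerm q B α α := by
  have h := hr.ae_eq hq hN hB
  rw [ae_restrict_iff' measurableSet_Ioi] at h ⊢
  filter_upwards [ae_comp_mul_left h (c := 2) two_ne_zero] with α h1 hα
  have hα : 0 < α := hα
  rw [aAmplitude, h1 (mem_Ioi.2 (by linarith)), mul_div_cancel_left₀ α two_ne_zero]
  ring

theorem exists_isResponseFunction (hq : LocallyIntegrable q) (hN : HasWindowBound q N) :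
    ∃ r, IsResponseFunction q r := by
  obtain ⟨κ, hκ, hρ⟩ := exists_weight hN.nonneg
  obtain ⟨B, hB, -⟩ := exists_isCharacteristicKernel hq hN hκ hρ
  exact ⟨_, _, hB.isGoursatSolution hq, hB.ae_hasDerivWithinAt hq
    (w := fun p => -(1 / 2) * B ((p.2 - p.1) / 2, (p.2 + p.1) / 2)) fun _ _ _ _ => rfl⟩

theorem exists_isVolterraKernel (hq : LocallyIntegrable q) (hN : HasWindowBound q N) :
    ∃ K, IsVolterraKernel q K := by
  obtain ⟨κ, hκ, hρ⟩ := exists_weight hN.nonneg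
  obtain ⟨B, hB, -⟩ := exists_isCharacteristicKernel hq hN hκ hρ
  exact ⟨_, hB.isVolterraKernel hq⟩

theorem IsResponseFunction.ae_aAmplitude_eq_diagonal (hq : LocallyIntegrable q)
    (hN : HasWindowBound q N) {r : ℝ → ℝ} (hr : IsResponseFunction q r) {K : ℝ → ℝ → ℝ}
    (hK : IsVolterraKernel q K) :
    ∀ᵐ α ∂(volume.restrict (Ioi (0 : ℝ))), aAmplitude r α = K α α := by
  obtain ⟨B, hB, hKB⟩ := hK.exists_isCharacteristicKernel hq
  have h := hr.ae_aAmplitude_eq hq hN hB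
  rw [ae_restrict_iff' measurableSet_Ioi] at h ⊢
  filter_upwards [h] with α h1 hα
  have hα0 : 0 < α := hα
  rw [h1 hα, hKB α α hα0.le le_rfl]

/-- Between the threshold and `Re k` there is a growth rate `κ` for which the kernel is
exponentially bounded. -/
theorem exists_isBoundedKernel (hq : LocallyIntegrable q) (hN : HasWindowBound q N) {k : ℂ}
    (hk : 2 * max (Real.sqrt (2 * N)) (Real.exp 1 * N) < k.re) :
    ∃ (κ M : ℝ) (B : ℝ × ℝ → ℝ), 0 < κ ∧ κ < k.re ∧ IsBoundedKernel q B κ M := by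
  obtain ⟨κ, h1, h2⟩ := exists_between hk
  obtain ⟨hκ, hρ⟩ := weight_lt_one hN.nonneg h1
  obtain ⟨B, hB, M, hM, hb⟩ := exists_isCharacteristicKernel hq hN hκ hρ
  exact ⟨κ, M, B, hκ, h2, ⟨hB, hM, hb⟩⟩

/-- The Weyl solution at `-k²`, its uniqueness, and the value of `m(-k²)`. -/
theorem IsBoundedKernel.weyl (hq : LocallyIntegrable q) (hN : HasWindowBound q N)
    {B : ℝ × ℝ → ℝ} {κ M : ℝ} {k : ℂ} (hB : IsBoundedKernel q B κ M) (hκ : 0 < κ)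
    (hk : κ < k.re) :
    (∃ u : ℝ → ℂ, IsWeylSolution q (-k ^ 2) u ∧ u 0 ≠ 0 ∧
      ∀ v : ℝ → ℂ, IsWeylSolution q (-k ^ 2) v → ∃ c : ℂ, ∀ x : ℝ, 0 ≤ x → v x = c * u x) ∧
    titchmarshWeylM q (-k ^ 2) = -k - laplaceDensity q k B 0 := by
  obtain ⟨u, u', hu, hu'c, hu', hu0, hu'0, C, ε, hε, hbd⟩ :=
    hB.exists_decaying_solution hq hN hκ hk
  have huc : Continuous u := continuous_iff_continuousAt.2 fun x => (hu x).continuousAt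
  have hu2 := integrableOn_sq_of_norm_le_exp huc hε fun x hx => (hbd x hx).1
  have hu'2 := integrableOn_sq_of_norm_le_exp hu'c hε fun x hx => (hbd x hx).2
  have hder {x : ℝ} (hx : 0 ≤ x) : derivWithin u (Ici 0) x = u' x :=
    (hu x).hasDerivWithinAt.derivWithin (uniqueDiffOn_Ici 0 x hx)
  have huW : IsWeylSolution q (-k ^ 2) u := by
    refine ⟨⟨fun x _ => (hu x).differentiableAt.differentiableWithinAt, fun x hx => ?_⟩,
      ⟨0, le_rfl, by simp [hu0]⟩, hu2⟩
    rw [hder hx, hder le_rfl]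
    exact hu' x hx
  have huniq {v : ℝ → ℂ} (hv : IsWeylSolution q (-k ^ 2) v) {x : ℝ} (hx : 0 ≤ x) :
      v x = v 0 * u x :=
    eq_mul_of_squareIntegrable hq hu hu'c hu' hu0 hu2 hu'2 hv.solution hv.squareIntegrable hx
  refine ⟨⟨u, huW, by simp [hu0], fun v hv => ⟨v 0, fun x hx => huniq hv hx⟩⟩, ?_⟩
  have hex : ∃ u : ℝ → ℂ, IsWeylSolution q (-k ^ 2) u := ⟨u, huW⟩
  rw [titchmarshWeylM, dif_pos hex]
  set v := hex.choose with hvdef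
  have hv : IsWeylSolution q (-k ^ 2) v := hex.choose_spec
  have hv0 : v 0 ≠ 0 := by
    intro h0
    obtain ⟨x, hx, hne⟩ := hv.nontrivial
    exact hne (by rw [huniq hv hx, h0, zero_mul])
  have hdv : derivWithin v (Ici 0) 0 = v 0 * u' 0 := by
    have h1 : HasDerivWithinAt v (v 0 * u' 0) (Ici 0) 0 :=
      (((hu 0).const_mul (v 0)).hasDerivWithinAt).congr (fun x hx => huniq hv hx)
        (huniq hv le_rfl)
    exact h1.derivWithin (uniqueDiffWithinAt_Ici 0)
  rw [hdv, mul_div_cancel_left₀ _ hv0, hu'0]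

/-- The two forms of the Laplace representation of the Titchmarsh-Weyl function. -/
theorem IsBoundedKernel.laplace_representation (hq : LocallyIntegrable q)
    (hN : HasWindowBound q N) {B : ℝ × ℝ → ℝ} {κ M : ℝ} {k : ℂ} (hB : IsBoundedKernel q B κ M)
    (hκ : 0 < κ) (hk : κ < k.re) {r : ℝ → ℝ} (hr : IsResponseFunction q r) :
    IntegrableOn
      (fun α : ℝ => (aAmplitude r α : ℂ) * Complex.exp (-2 * (α : ℂ) * k)) (Ioi 0) ∧
    ∫ α in Ioi (0 : ℝ), (aAmplitude r α : ℂ) * Complex.exp (-2 * (α : ℂ) * k)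
      = laplaceDensity q k B 0 ∧
    IntegrableOn (fun s : ℝ => Complex.exp (-k * (s : ℂ)) * (r s : ℂ)) (Ioi 0) ∧
    ∫ s in Ioi (0 : ℝ), Complex.exp (-k * (s : ℂ)) * (r s : ℂ) = -laplaceDensity q k B 0 := by
  have hi := hB.integrableOn_laplaceDensity hq hN hκ hk le_rfl
  have hae : (fun α : ℝ => (aAmplitude r α : ℂ) * Complex.exp (-2 * (α : ℂ) * k))
      =ᵐ[volume.restrict (Ioi 0)] fun v : ℝ => Complex.exp (-2 * k * v)
        * ((q (v + 0) - innerTerm q B v (v + 0) : ℝ) : ℂ) := by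
    filter_upwards [hr.ae_aAmplitude_eq hq hN hB.toIsCharacteristicKernel] with α hα
    rw [hα, add_zero, mul_comm]
    congr 2
    ring
  have hA : IntegrableOn
      (fun α : ℝ => (aAmplitude r α : ℂ) * Complex.exp (-2 * (α : ℂ) * k)) (Ioi 0) :=
    hi.congr hae.symm
  have hAe : ∫ α in Ioi (0 : ℝ), (aAmplitude r α : ℂ) * Complex.exp (-2 * (α : ℂ) * k)
      = laplaceDensity q k B 0 := integral_congr_ae hae
  -- the substitution `s = 2 α`
  let f : ℝ → ℂ := fun s => Complex.exp (-k * (s : ℂ)) * (r s : ℂ)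
  have hf (α : ℝ) : f (2 * α)
      = -(1 / 2) * ((aAmplitude r α : ℂ) * Complex.exp (-2 * (α : ℂ) * k)) := by
    simp only [f, aAmplitude]
    rw [show -k * ((2 * α : ℝ) : ℂ) = -2 * (α : ℂ) * k by push_cast; ring]
    push_cast
    ring
  refine ⟨hA, hAe, ?_, ?_⟩
  · have h := (integrableOn_Ioi_comp_mul_left_iff f 0 (two_pos (α := ℝ))).1 (by
      simp only [hf]
      exact hA.const_mul _)
    rw [mul_zero] at h
    exact h
  · have h := integral_comp_mul_left_Ioi f 0 (two_pos (α := ℝ))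
    simp only [hf, mul_zero] at h
    rw [integral_const_mul, hAe] at h
    change ∫ s in Ioi (0 : ℝ), f s = _
    rw [Complex.real_smul] at h
    push_cast at h
    linear_combination -2 * h

end LocallyIntegrablePotential

theorem mainTheorem3 (q : ℝ → ℝ) (hq : IsUniformlyLocallyIntegrable q) :
    (∃ r : ℝ → ℝ, IsResponseFunction q r) ∧
    (∃ K : ℝ → ℝ → ℝ, IsVolterraKernel q K) ∧
    (∀ k : ℂ,
      2 * max (Real.sqrt (2 * windowNorm q)) (Real.exp 1 * windowNorm q) < k.re →
      ∃ u : ℝ → ℂ, IsWeylSolution q (-k ^ 2) u ∧ u 0 ≠ 0 ∧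
        ∀ v : ℝ → ℂ, IsWeylSolution q (-k ^ 2) v →
          ∃ c : ℂ, ∀ x : ℝ, 0 ≤ x → v x = c * u x) ∧
    ∀ r : ℝ → ℝ, IsResponseFunction q r →
      (∀ K : ℝ → ℝ → ℝ, IsVolterraKernel q K →
        ∀ᵐ α ∂(volume.restrict (Ioi (0 : ℝ))), aAmplitude r α = K α α) ∧
      ∀ k : ℂ,
        2 * max (Real.sqrt (2 * windowNorm q)) (Real.exp 1 * windowNorm q) < k.re →
        IntegrableOn
          (fun α : ℝ => (aAmplitude r α : ℂ) * Complex.exp (-2 * (α : ℂ) * k)) (Ioi 0) ∧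
        titchmarshWeylM q (-k ^ 2)
          = -k - ∫ α in Ioi (0 : ℝ), (aAmplitude r α : ℂ) * Complex.exp (-2 * (α : ℂ) * k) ∧
        IntegrableOn (fun s : ℝ => Complex.exp (-k * (s : ℂ)) * (r s : ℂ)) (Ioi 0) ∧
        titchmarshWeylM q (-k ^ 2)
          = -k + ∫ s in Ioi (0 : ℝ), Complex.exp (-k * (s : ℂ)) * (r s : ℂ) := by
  -- only the values of `q` on the half-line matter, so `q` may be extended by zero
  set q₀ := (Ici (0 : ℝ)).indicator q with hq₀
  have hL : LocallyIntegrable q₀ := hq.locallyIntegrable_indicator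
  have hN : HasWindowBound q₀ (windowNorm q) := hq.hasWindowBound
  have h₁ : ∀ x, 0 ≤ x → q x = q₀ x := fun x hx => (indicator_of_mem (mem_Ici.2 hx) q).symm
  have h₂ : ∀ x, 0 ≤ x → q₀ x = q x := fun x hx => (h₁ x hx).symm
  refine ⟨?_, ?_, fun k hk => ?_, fun r hr => ⟨fun K hK => ?_, fun k hk => ?_⟩⟩
  · obtain ⟨r, hr⟩ := exists_isResponseFunction hL hN
    exact ⟨r, hr.congr h₂⟩
  · obtain ⟨K, hK⟩ := exists_isVolterraKernel hL hN
    exact ⟨K, hK.congr h₂⟩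
  · obtain ⟨κ, M, B, hκ, hκk, hB⟩ := exists_isBoundedKernel hL hN hk
    obtain ⟨⟨u, hu, hu0, huniq⟩, -⟩ := hB.weyl hL hN hκ hκk
    exact ⟨u, hu.congr h₂, hu0, fun v hv => huniq v (hv.congr h₁)⟩
  · exact (hr.congr h₁).ae_aAmplitude_eq_diagonal hL hN (hK.congr h₁)
  · obtain ⟨κ, M, B, hκ, hκk, hB⟩ := exists_isBoundedKernel hL hN hk
    obtain ⟨-, hm⟩ := hB.weyl hL hN hκ hκk
    obtain ⟨i1, e1, i2, e2⟩ := hB.laplace_representation hL hN hκ hκk (hr.congr h₁)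
    rw [titchmarshWeylM_congr h₁, hm, e1, e2]
    exact ⟨i1, rfl, i2, sub_eq_add_neg _ _⟩
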